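/- Fix a field $\mathbb{F}$. A finite filtered space $\mathbf X=(X,F_X)$ is a finite set $X$ with a function $F_X:\mathrm{pow}(X)\to\mathbb{R}$ on its power set such that $F_X(\sigma)\le F_X(\tau)$ whenever $\sigma\subseteq\tau$. For $\varepsilon\in\mathbb{R}$ let $L_\varepsilon(\mathbf X)$ be the simplicial complex whose simplices are the nonempty $\sigma\subseteq X$ with $F_X(\sigma)\le\varepsilon$. For $k\ge 0$, let $\mathbb V_k(\mathbf X)$ be the persistence vector space formed by the (unreduced) homology spaces $H_k(L_\varepsilon(\mathbf X);\mathbb F)$ and the maps induced by the inclusions $L_\varepsilon(\mathbf X)\subseteq L_{\varepsilon'}(\mathbf X)$, $\varepsilon\le\varepsilon'$. Its persistence diagram $\mathrm D_k(\mathbf X)$ is the finite multiset of pairs $(b,d)$ with $b\in\mathbb R$, $d\in\mathbb R\cup\{\infty\}$, $b<d$, such that $\mathbb V_k(\mathbf X)$ is isomorphic to the direct sum of the interval modules of the intervals $[b,d)$. The bottleneck distance $d_{\mathcal D}(D_1,D_2)\in[0,\infty]$ of two finite diagrams is the minimum, over all bijections $\varphi$ from a part of $D_1$ to a part of $D_2$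 (points counted with multiplicity), of the maximum of the numbers $\|P-\varphi(P)\|_\infty$ for the matched points $P$ and $\frac12(d-b)$ for the unmatched points $(b,d)$ of $D_1$ and of $D_2$; here $|\infty-\infty|=0$ and $|\infty-d|=\infty$ for finite $d$. The length $\mathrm L_{\mathcal D}(\alpha)\in[0,\infty]$ of a curve $\alpha$ of diagrams on $[0,1]$ is the supremum of $\sum_{i=0}^{n-1}d_{\mathcal D}(\alpha(t_i),\alpha(t_{i+1}))$ over all partitions $0=t_0<t_1<\dots<t_n=1$. A tripod $T=(Z,\varphi_X,\varphi_Y)$ between $\mathbf X$ and $\mathbf Y$ is a finite set $Z$ with surjections $\varphi_X:Z\to X$ and $\varphi_Y:Z\to Y$. Its cost is $\max_{\tau\subseteq Z}|F_X(\varphi_X(\tau))-F_Y(\varphi_Y(\tau))|$, and $d_{\mathcal F}(\mathbf X,\mathbf Y)\in[0,\infty]$ is the infimum of the costs of all tripods. $T$ is optimal if its cost equals $d_{\mathcal F}(\mathbf X,\mathbf Y)$; let $\mathcal T^{\mathrm{opt}}(\mathbf X,\mathbf Y)$ be the collection of the optimal tripods. The straight-line curve of $T$ is $\gamma_T(t)=(Z,F_t)$,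 $t\in[0,1]$, where $F_t(\tau)=(1-t)F_X(\varphi_X(\tau))+tF_Y(\varphi_Y(\tau))$. **Theorem.** Let $k\ge 0$ and let $\mathbf X,\mathbf Y$ be finite filtered spaces. 1. The persistence diagram $\mathrm D_k(\mathbf W)$ of every finite filtered space $\mathbf W$ exists and is unique. 2. One has $$\sup_{T\in\mathcal T^{\mathrm{opt}}(\mathbf X,\mathbf Y)}\mathrm L_{\mathcal D}\big(\mathrm D_k(\gamma_T)\big)\le d_{\mathcal F}(\mathbf X,\mathbf Y).$$ 3. This bound is at least as strong as the stability bound $d_{\mathcal D}(\mathrm D_k(\mathbf X),\mathrm D_k(\mathbf Y))\le d_{\mathcal F}(\mathbf X,\mathbf Y)$: for every $T\in\mathcal T^{\mathrm{opt}}(\mathbf X,\mathbf Y)$, $$d_{\mathcal D}\big(\mathrm D_k(\mathbf X),\mathrm D_k(\mathbf Y)\big)\le \mathrm L_{\mathcal D}\big(\mathrm D_k(\gamma_T)\big),$$ and $\mathcal T^{\mathrm{opt}}(\mathbf X,\mathbf Y)$ is not empty if $X$ and $Y$ are nonempty. -/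

import Mathlib

universe u v w

noncomputable section

/-! ### Simplicial homology with field coefficients -/

/-- The free vector space on all `(k+1)`-tuples of vertices (repetitions are allowed). -/
abbrev OrderedChain (𝕜 : Type v) [Field 𝕜] (V : Type u) (k : ℕ) : Type (max u v) :=
  (Fin (k + 1) → V) →₀ 𝕜

/-- The boundary `∂(x₀,…,xₖ₊₁) = ∑ᵢ (-1)ⁱ (x₀,…,x̂ᵢ,…,xₖ₊₁)`. -/
def orderedBoundary (𝕜 : Type v) [Field 𝕜] (V : Type u) (k : ℕ) :
    OrderedChain 𝕜 V (k + 1) →ₗ[𝕜] OrderedChain 𝕜 V k :=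
  Finsupp.lsum 𝕜 fun x : Fin (k + 1 + 1) → V =>
    ∑ i : Fin (k + 1 + 1),
      ((-1 : 𝕜) ^ (i : ℕ)) • Finsupp.lsingle (R := 𝕜) (M := 𝕜) fun j => x (i.succAbove j)

open Classical in
/-- The ordered simplicial `k`-chains of `L`: the linear combinations of tuples `(x₀,…,xₖ)` of
not necessarily distinct vertices for which `{x₀,…,xₖ}` is a simplex of `L`. -/
def chainsOf (𝕜 : Type v) [Field 𝕜] {V : Type u} (L : PreAbstractSimplicialComplex V) (k : ℕ) :
    Submodule 𝕜 (OrderedChain 𝕜 V k) :=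
  Finsupp.supported 𝕜 𝕜 {x : Fin (k + 1) → V | Finset.univ.image x ∈ L.faces}

/-- The `k`-cycles of `L`; every `0`-chain is a cycle, so the homology below is not reduced. -/
def cyclesOf (𝕜 : Type v) [Field 𝕜] {V : Type u} (L : PreAbstractSimplicialComplex V) :
    (k : ℕ) → Submodule 𝕜 (OrderedChain 𝕜 V k)
  | 0 => chainsOf 𝕜 L 0
  | k + 1 => chainsOf 𝕜 L (k + 1) ⊓ LinearMap.ker (orderedBoundary 𝕜 V k)

/-- The `k`-boundaries of `L`. -/
def boundariesOf (𝕜 : Type v) [Field 𝕜] {V : Type u} (L : PreAbstractSimplicialComplex V)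
    (k : ℕ) : Submodule 𝕜 (OrderedChain 𝕜 V k) :=
  (chainsOf 𝕜 L (k + 1)).map (orderedBoundary 𝕜 V k)

/-- The quotient `Z / B` of two subspaces (that is `Z / (Z ∩ B)` if `B` is not inside `Z`). -/
def Subquotient {𝕜 : Type v} [Field 𝕜] {C : Type u} [AddCommGroup C] [Module 𝕜 C]
    (Z B : Submodule 𝕜 C) : Type u :=
  Z ⧸ B.submoduleOf Z

instance {𝕜 : Type v} [Field 𝕜] {C : Type u} [AddCommGroup C] [Module 𝕜 C]
    (Z B : Submodule 𝕜 C) : AddCommGroup (Subquotient Z B) :=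
  inferInstanceAs (AddCommGroup (Z ⧸ B.submoduleOf Z))

instance {𝕜 : Type v} [Field 𝕜] {C : Type u} [AddCommGroup C] [Module 𝕜 C]
    (Z B : Submodule 𝕜 C) : Module 𝕜 (Subquotient Z B) :=
  inferInstanceAs (Module 𝕜 (Z ⧸ B.submoduleOf Z))

/-- The map `Z / B → Z' / B'` induced by the inclusions `Z ⊆ Z'` and `B ⊆ B'`. -/
def subquotientInclusion {𝕜 : Type v} [Field 𝕜] {C : Type u} [AddCommGroup C] [Module 𝕜 C]
    {Z B Z' B' : Submodule 𝕜 C} (hZ : Z ≤ Z') (hB : B ≤ B') :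
    Subquotient Z B →ₗ[𝕜] Subquotient Z' B' :=
  Submodule.mapQ (B.submoduleOf Z) (B'.submoduleOf Z') (Submodule.inclusion hZ) fun _ hx => hB hx

/-- Simplicial homology `H_k(L; 𝕜)`, cycles modulo boundaries, of the ordered chain complex. -/
abbrev simplicialHomology (𝕜 : Type v) [Field 𝕜] {V : Type u}
    (L : PreAbstractSimplicialComplex V) (k : ℕ) : Type (max u v) :=
  Subquotient (cyclesOf 𝕜 L k) (boundariesOf 𝕜 L k)

theorem chainsOf_mono (𝕜 : Type v) [Field 𝕜] {V : Type u}
    {L M : PreAbstractSimplicialComplex V} (h : L ≤ M) (k : ℕ) :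
    chainsOf 𝕜 L k ≤ chainsOf 𝕜 M k :=
  Finsupp.supported_mono fun _ hx => h hx

theorem cyclesOf_mono (𝕜 : Type v) [Field 𝕜] {V : Type u}
    {L M : PreAbstractSimplicialComplex V} (h : L ≤ M) (k : ℕ) :
    cyclesOf 𝕜 L k ≤ cyclesOf 𝕜 M k := by
  cases k with
  | zero => exact chainsOf_mono 𝕜 h 0
  | succ k => exact inf_le_inf_right _ (chainsOf_mono 𝕜 h (k + 1))

theorem boundariesOf_mono (𝕜 : Type v) [Field 𝕜] {V : Type u}
    {L M : PreAbstractSimplicialComplex V} (h : L ≤ M) (k : ℕ) :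
    boundariesOf 𝕜 L k ≤ boundariesOf 𝕜 M k :=
  Submodule.map_mono (chainsOf_mono 𝕜 h (k + 1))

/-- The map `H_k(L) → H_k(M)` induced by an inclusion `L ⊆ M`. -/
def homologyInclusion (𝕜 : Type v) [Field 𝕜] {V : Type u}
    {L M : PreAbstractSimplicialComplex V} (h : L ≤ M) (k : ℕ) :
    simplicialHomology 𝕜 L k →ₗ[𝕜] simplicialHomology 𝕜 M k :=
  subquotientInclusion (cyclesOf_mono 𝕜 h k) (boundariesOf_mono 𝕜 h k)

/-! ### Persistence vector spaces and their barcodes -/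

/-- A persistence vector space over `𝕜`, indexed by the real line. -/
structure PersistenceModule (𝕜 : Type v) [Field 𝕜] where
  space : ℝ → Type w
  [addCommGroup : ∀ s, AddCommGroup (space s)]
  [module : ∀ s, Module 𝕜 (space s)]
  map : ∀ {s t : ℝ}, s ≤ t → (space s →ₗ[𝕜] space t)
  map_refl : ∀ (s : ℝ) (x : space s), map (le_refl s) x = x
  map_trans : ∀ {r s t : ℝ} (hrs : r ≤ s) (hst : s ≤ t) (x : space r),
    map hst (map hrs x) = map (hrs.trans hst) x

attribute [instance] PersistenceModule.addCommGroup PersistenceModule.module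

/-- An isomorphism of persistence vector spaces. -/
structure PersistenceModule.Iso {𝕜 : Type v} [Field 𝕜] (M : PersistenceModule.{v, u} 𝕜)
    (N : PersistenceModule.{v, w} 𝕜) where
  equiv : ∀ s, M.space s ≃ₗ[𝕜] N.space s
  comm : ∀ {s t : ℝ} (h : s ≤ t) (x : M.space s), equiv t (M.map h x) = N.map h (equiv s x)

/-- A point `(b, d)` of a persistence diagram, `b ≤ d`; the death time `d` may be `∞`. -/
@[ext]
structure DiagramPoint where
  birth : ℝ
  death : WithTop ℝ
  birth_le_death : (birth : WithTop ℝ) ≤ death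

/-- The interval `[b, d)` that belongs to the point `(b, d)`. -/
def DiagramPoint.interval (P : DiagramPoint) : Set ℝ :=
  {s | P.birth ≤ s ∧ (s : WithTop ℝ) < P.death}

/-- A persistence diagram: a finite multiset of points. -/
abbrev PersistenceDiagram : Type := Multiset DiagramPoint

/-- The subspace of the line `𝕜` that the interval module of `P` has at the parameter `s`: all of
`𝕜` if `s` lies in the interval, and `0` otherwise. -/
def intervalSpace (𝕜 : Type v) [Field 𝕜] (P : DiagramPoint) (s : ℝ) : Submodule 𝕜 𝕜 where
  carrier := {x | s ∉ P.interval → x = 0}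
  add_mem' hx hy h := by rw [hx h, hy h, add_zero]
  zero_mem' _ := rfl
  smul_mem' c x hx h := by rw [hx h, smul_zero]

open Classical in
/-- The structure map of the interval module from the parameter `s` to the parameter `t`: the
identity of `𝕜` if `t` (and `s`) lies in the interval, and `0` otherwise. -/
def intervalMap (𝕜 : Type v) [Field 𝕜] (P : DiagramPoint) (s t : ℝ) :
    intervalSpace 𝕜 P s →ₗ[𝕜] intervalSpace 𝕜 P t where
  toFun x := ⟨if t ∈ P.interval then (x : 𝕜) else 0, fun h => if_neg h⟩
  map_add' x y := by
    ext
    by_cases h : t ∈ P.interval <;> simp [h]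
  map_smul' c x := by
    ext
    by_cases h : t ∈ P.interval <;> simp [h]

/-- The interval module of the interval `[b, d)`. -/
def intervalModule (𝕜 : Type v) [Field 𝕜] (P : DiagramPoint) : PersistenceModule.{v, v} 𝕜 where
  space s := intervalSpace 𝕜 P s
  map {s t} _ := intervalMap 𝕜 P s t
  map_refl s x := by
    ext
    by_cases h : s ∈ P.interval
    · simp [intervalMap, h]
    · simp [intervalMap, h, x.2 h]
  map_trans {r s t} hrs hst x := by
    ext
    by_cases ht : t ∈ P.interval
    · by_cases hs : s ∈ P.interval
      · simp [intervalMap, hs, ht]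
      · have hr : r ∉ P.interval := fun hr =>
          hs ⟨hr.1.trans hrs, lt_of_le_of_lt (WithTop.coe_le_coe.mpr hst) ht.2⟩
        simp [intervalMap, hs, ht, x.2 hr]
    · simp [intervalMap, ht]

/-- The direct sum of a finite family of persistence vector spaces. -/
def PersistenceModule.finiteSum {𝕜 : Type v} [Field 𝕜] {A : Type} [Fintype A]
    (M : A → PersistenceModule.{v, w} 𝕜) : PersistenceModule.{v, w} 𝕜 where
  space s := ∀ a, (M a).space s
  map h := LinearMap.pi fun a => (M a).map h ∘ₗ LinearMap.proj a
  map_refl s x := by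
    funext a
    exact (M a).map_refl s (x a)
  map_trans hrs hst x := by
    funext a
    exact (M a).map_trans hrs hst (x a)

/-- `D` is the multiset of intervals of `M`: it consists of points `(b, d)` with `b < d`, and `M`
is isomorphic to the direct sum of the interval modules of the intervals `[b, d)`. -/
def IsBarcode {𝕜 : Type v} [Field 𝕜] (M : PersistenceModule.{v, w} 𝕜) (D : PersistenceDiagram) :
    Prop :=
  ∃ (A : Type) (_ : Fintype A) (P : A → DiagramPoint),
    (Finset.univ : Finset A).val.map P = D ∧
    (∀ a, ((P a).birth : WithTop ℝ) < (P a).death) ∧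
    Nonempty (M.Iso (PersistenceModule.finiteSum fun a => intervalModule 𝕜 (P a)))

/-! ### The bottleneck distance -/

/-- The distance of two death times, with `|∞ - ∞| = 0` and `|∞ - d| = ∞` for finite `d`. -/
def deathDist : WithTop ℝ → WithTop ℝ → ENNReal
  | some d, some e => ENNReal.ofReal |d - e|
  | none, none => 0
  | _, _ => ⊤

/-- The distance `‖P - Q‖_∞` of two points. -/
def DiagramPoint.supDist (P Q : DiagramPoint) : ENNReal :=
  max (ENNReal.ofReal |P.birth - Q.birth|) (deathDist P.death Q.death)

/-- The persistence `d - b` of the point `(b, d)`. -/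
def DiagramPoint.pers (P : DiagramPoint) : ENNReal :=
  deathDist P.death P.birth

/-- The cost of a partial matching: `M` is the multiset of matched pairs, and `R₁` and `R₂` are the
multisets of the unmatched points of the first and of the second diagram. -/
def matchingCost (M : Multiset (DiagramPoint × DiagramPoint)) (R₁ R₂ : Multiset DiagramPoint) :
    ENNReal :=
  max (⨆ p ∈ M, p.1.supDist p.2) (max (⨆ P ∈ R₁, P.pers / 2) (⨆ Q ∈ R₂, Q.pers / 2))

/-- The bottleneck distance: the least cost of a partial matching, that is of a bijection between
a part `M.map Prod.fst` of `D₁` and a part `M.map Prod.snd` of `D₂`, counted with multiplicity. -/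
def bottleneckDist (D₁ D₂ : PersistenceDiagram) : ENNReal :=
  ⨅ (M : Multiset (DiagramPoint × DiagramPoint)) (R₁ : Multiset DiagramPoint)
    (R₂ : Multiset DiagramPoint) (_ : M.map Prod.fst + R₁ = D₁) (_ : M.map Prod.snd + R₂ = D₂),
    matchingCost M R₁ R₂

/-! ### Filtered spaces and their persistence diagrams -/

/-- A finite filtered space: a finite set `X` and a monotone function `pow X → ℝ`. -/
structure FilteredSpace where
  carrier : Type u
  [finite : Finite carrier]
  filt : Finset carrier → ℝ
  mono : Monotone filt

attribute [instance] FilteredSpace.finite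

/-- The simplicial complex `L_ε(X)`, whose simplices are the nonempty `σ ⊆ X` with
`F_X(σ) ≤ ε`. -/
def FilteredSpace.sublevel (X : FilteredSpace.{u}) (ε : ℝ) :
    PreAbstractSimplicialComplex X.carrier where
  faces := {σ | σ.Nonempty ∧ X.filt σ ≤ ε}
  isRelLowerSet_faces := fun _ hσ =>
    ⟨hσ.1, fun _ hτσ hτ => ⟨hτ, (X.mono hτσ).trans hσ.2⟩⟩

theorem FilteredSpace.sublevel_mono (X : FilteredSpace.{u}) {ε δ : ℝ} (h : ε ≤ δ) :
    X.sublevel ε ≤ X.sublevel δ :=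
  fun _ hσ => ⟨hσ.1, hσ.2.trans h⟩

/-- The persistence vector space `V_k(X)`, which is the `k`-th homology of the filtration
`(L_ε(X))_ε` with the maps induced by the inclusions. -/
def FilteredSpace.persistentHomology (𝕜 : Type v) [Field 𝕜] (k : ℕ) (X : FilteredSpace.{u}) :
    PersistenceModule.{v, max u v} 𝕜 where
  space ε := simplicialHomology 𝕜 (X.sublevel ε) k
  map h := homologyInclusion 𝕜 (X.sublevel_mono h) k
  map_refl _ x := Submodule.Quotient.induction_on _ x fun _ => rfl
  map_trans _ _ x := Submodule.Quotient.induction_on _ x fun _ => rfl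

/-- The persistence diagram `D_k(X)`: the multiset of intervals of `V_k(X)`. -/
def FilteredSpace.diagram (𝕜 : Type v) [Field 𝕜] (k : ℕ) (X : FilteredSpace.{u}) :
    PersistenceDiagram :=
  Classical.epsilon fun D => IsBarcode (X.persistentHomology 𝕜 k) D

/-! ### Tripods, the distance of filtered spaces, and the curve of a tripod -/

/-- A tripod: a finite set `Z` with surjections onto `X` and `Y`. -/
structure Tripod (X Y : FilteredSpace.{u}) where
  Z : Type u
  [finite : Finite Z]
  toX : Z → X.carrier
  toY : Z → Y.carrier
  surjective_toX : Function.Surjective toX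
  surjective_toY : Function.Surjective toY

attribute [instance] Tripod.finite

open Classical in
/-- The pullback filtration `τ ↦ F_X(φ(τ))`, as a function on the power set of `Z`. -/
def FilteredSpace.pullback (X : FilteredSpace.{u}) {Z : Type u} (φ : Z → X.carrier)
    (τ : Finset Z) : ℝ :=
  X.filt (τ.image φ)

open Classical in
theorem FilteredSpace.pullback_mono (X : FilteredSpace.{u}) {Z : Type u} (φ : Z → X.carrier) :
    Monotone (X.pullback φ) :=
  fun _ _ h => X.mono (Finset.image_subset_image h)

/-- The maximum of `|φ_X^* F_X - φ_Y^* F_Y|` over the power set of `Z`. -/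
def Tripod.cost {X Y : FilteredSpace.{u}} (T : Tripod X Y) : ENNReal :=
  ⨆ τ : Finset T.Z, ENNReal.ofReal |X.pullback T.toX τ - Y.pullback T.toY τ|

/-- The distance `d_F(X, Y)`: the infimum of the costs of all tripods (`∞` if there is none, which
happens only if exactly one of the two sets is empty). -/
def filteredDist (X Y : FilteredSpace.{u}) : ENNReal :=
  ⨅ T : Tripod X Y, T.cost

/-- A tripod that attains the infimum. -/
def Tripod.IsOptimal {X Y : FilteredSpace.{u}} (T : Tripod X Y) : Prop :=
  T.cost = filteredDist X Y

/-- The straight-line curve `γ_T(t) = (Z, (1 - t) φ_X^* F_X + t φ_Y^* F_Y)`, `0 ≤ t ≤ 1`. -/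
def Tripod.curve {X Y : FilteredSpace.{u}} (T : Tripod X Y) (t : unitInterval) : FilteredSpace.{u} where
  carrier := T.Z
  filt τ := (1 - (t : ℝ)) * X.pullback T.toX τ + (t : ℝ) * Y.pullback T.toY τ
  mono _ _ h := add_le_add
    (mul_le_mul_of_nonneg_left (X.pullback_mono T.toX h) (sub_nonneg.mpr t.2.2))
    (mul_le_mul_of_nonneg_left (Y.pullback_mono T.toY h) t.2.1)

/-- The length of a curve `α : [0,1] → 𝒟` in the bottleneck distance: the supremum of
`∑ᵢ d(α(tᵢ), α(tᵢ₊₁))` over all partitions `0 = t₀ < t₁ < ⋯ < tₙ = 1`. -/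
def diagramLength (α : unitInterval → PersistenceDiagram) : ENNReal :=
  ⨆ (n : ℕ) (t : Fin (n + 1) → unitInterval)
    (_ : StrictMono t ∧ t 0 = 0 ∧ t (Fin.last n) = 1),
    ∑ i : Fin n, bottleneckDist (α (t i.castSucc)) (α (t i.succ))

end

/-! ### Bases adapted to two chains of subspaces -/

/-- A submodule of a finite-dimensional space has a basis adapted to two chains of submodules. -/
theorem exists_linearIndepOn_adapted {𝕜 : Type v} [Field 𝕜] {V : Type w} [AddCommGroup V]
    [Module 𝕜 V] [FiniteDimensional 𝕜 V] {C₁ C₂ : Set (Submodule 𝕜 V)}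
    (h₁ : IsChain (· ≤ ·) C₁) (h₂ : IsChain (· ≤ ·) C₂) (U : Submodule 𝕜 V) :
    ∃ s : Set V, LinearIndepOn 𝕜 id s ∧ Submodule.span 𝕜 s = U ∧
      ∀ W ∈ C₁ ∪ C₂, W ⊓ U ≤ Submodule.span 𝕜 (s ∩ W) := by
  induction U using WellFoundedLT.induction with
  | ind U ih =>
  rcases eq_or_ne U ⊥ with rfl | hU
  · exact ⟨∅, linearIndepOn_empty _ _, by simp, by simp⟩
  -- `K` is the largest proper trace on `U` of a member of `C₁`. With `U'` a hyperplane of `U` above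
  -- `K`, each member of `C₁` contains `U` or meets it inside `U'`.
  obtain ⟨K, hKU, hK⟩ : ∃ K < U, ∀ W ∈ C₁, ¬ U ≤ W → W ⊓ U ≤ K := by
    rcases Set.eq_empty_or_nonempty {W ∈ C₁ | ¬ U ≤ W} with he | hne
    · exact ⟨⊥, bot_lt_iff_ne_bot.mpr hU, fun W hW hUW =>
        absurd (show W ∈ {W ∈ C₁ | ¬ U ≤ W} from ⟨hW, hUW⟩) (by simp [he])⟩
    · obtain ⟨M, hM⟩ := exists_maximal_of_wellFoundedGT (fun W => W ∈ {W ∈ C₁ | ¬ U ≤ W}) hne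
      refine ⟨M ⊓ U, lt_of_le_of_ne inf_le_right fun h => hM.1.2 (inf_eq_right.mp h), ?_⟩
      intro W hW hUW
      refine inf_le_inf_right _ ?_
      rcases h₁.total hW hM.1.1 with h | h
      · exact h
      · exact hM.2 ⟨hW, hUW⟩ h
  obtain ⟨U', hKU', hcov⟩ := exists_le_covBy_of_lt hKU
  obtain ⟨s, hs, hsU, hsW⟩ := ih U' hcov.lt
  -- The new vector is taken from the smallest member of `C₂` whose trace leaves `U'`, so it lies in
  -- all such members at once.
  obtain ⟨v, hvU, hvU', hv⟩ : ∃ v ∈ U, v ∉ U' ∧ ∀ W ∈ C₂, ¬ W ⊓ U ≤ U' → v ∈ W := by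
    rcases Set.eq_empty_or_nonempty {W ∈ C₂ | ¬ W ⊓ U ≤ U'} with he | hne
    · obtain ⟨v, hv, hv'⟩ := SetLike.exists_of_lt hcov.lt
      exact ⟨v, hv, hv', fun W hW hUW =>
        absurd (show W ∈ {W ∈ C₂ | ¬ W ⊓ U ≤ U'} from ⟨hW, hUW⟩) (by simp [he])⟩
    · obtain ⟨M, hM⟩ := exists_minimal_of_wellFoundedLT (fun W => W ∈ {W ∈ C₂ | ¬ W ⊓ U ≤ U'}) hne
      obtain ⟨v, hv, hv'⟩ := SetLike.not_le_iff_exists.mp hM.1.2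
      refine ⟨v, hv.2, hv', fun W hW hUW => ?_⟩
      rcases h₂.total hW hM.1.1 with h | h
      · exact hM.2 ⟨hW, hUW⟩ h hv.1
      · exact h hv.1
  have hsup : U' ⊔ Submodule.span 𝕜 {v} = U := by
    refine (hcov.eq_or_eq le_sup_left
      (sup_le hcov.le ((Submodule.span_singleton_le_iff_mem _ _).mpr hvU))).resolve_left
        fun h => hvU' ?_
    rw [← h]
    exact Submodule.mem_sup_right (Submodule.mem_span_singleton_self v)
  have hspan : Submodule.span 𝕜 (insert v s) = U := by
    rw [Submodule.span_insert, hsU, sup_comm, hsup]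
  refine ⟨insert v s, ?_, hspan, ?_⟩
  · refine hs.insert ?_
    rwa [Set.image_id, hsU]
  have hle : ∀ W ∈ C₁ ∪ C₂, W ⊓ U ≤ U' → W ⊓ U ≤ Submodule.span 𝕜 (insert v s ∩ W) := by
    intro W hW h
    calc W ⊓ U ≤ W ⊓ U' := le_inf inf_le_left h
      _ ≤ _ := hsW W hW
      _ ≤ _ := Submodule.span_mono (Set.inter_subset_inter_left _ (Set.subset_insert _ _))
  rintro W (hW | hW)
  · by_cases hUW : U ≤ W
    · rw [Set.inter_eq_left.mpr, hspan]
      · exact inf_le_right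
      · exact (hspan ▸ Submodule.subset_span : insert v s ⊆ (U : Set V)).trans hUW
    · exact hle W (Or.inl hW) ((hK W hW hUW).trans hKU')
  · by_cases hUW : W ⊓ U ≤ U'
    · exact hle W (Or.inr hW) hUW
    · have hvW := hv W hW hUW
      have hvW' : Submodule.span 𝕜 {v} ≤ W := (Submodule.span_singleton_le_iff_mem _ _).mpr hvW
      -- The modular law splits `W ⊓ U` into the line of `v` and `W ⊓ U'`.
      rw [← hsup, sup_comm, inf_comm, sup_inf_assoc_of_le _ hvW', Set.insert_inter_of_mem hvW,
        Submodule.span_insert]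
      refine sup_le_sup_left ?_ _
      rw [inf_comm]
      exact hsW W (Or.inr hW)

/-- A basis `β` is adapted to `W` if `W` is spanned by members of `β`. -/
def Module.Basis.IsAdapted {ι : Type*} {𝕜 : Type v} [Field 𝕜] {V : Type w} [AddCommGroup V]
    [Module 𝕜 V] (β : Module.Basis ι 𝕜 V) (W : Submodule 𝕜 V) : Prop :=
  ∀ x ∈ W, ∀ i, β.repr x i ≠ 0 → β i ∈ W

theorem exists_basis_adapted {𝕜 : Type v} [Field 𝕜] {V : Type w} [AddCommGroup V]
    [Module 𝕜 V] [FiniteDimensional 𝕜 V] {C₁ C₂ : Set (Submodule 𝕜 V)}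
    (h₁ : IsChain (· ≤ ·) C₁) (h₂ : IsChain (· ≤ ·) C₂) :
    ∃ (n : ℕ) (β : Module.Basis (Fin n) 𝕜 V), ∀ W ∈ C₁ ∪ C₂, β.IsAdapted W := by
  obtain ⟨s, hs, hsU, hsW⟩ := exists_linearIndepOn_adapted h₁ h₂ ⊤
  let b : Module.Basis s 𝕜 V := Module.Basis.mk hs (by simp [hsU])
  have hfin : Finite s := Module.Finite.finite_basis b
  refine ⟨_, b.reindex (Finite.equivFin s), fun W hW x hx i hi => ?_⟩
  have hx' : x ∈ Submodule.span 𝕜 (b '' {j | (j : V) ∈ W}) := by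
    have := hsW W hW ⟨hx, trivial⟩
    convert this using 2
    ext y
    constructor
    · rintro ⟨j, hj, rfl⟩
      simpa [b] using hj
    · rintro ⟨hy, hyW⟩
      exact ⟨⟨y, hy⟩, hyW, by simp [b]⟩
  rw [Module.Basis.mem_span_image] at hx'
  have hi' : b.repr x ((Finite.equivFin s).symm i) ≠ 0 := by
    rwa [Module.Basis.repr_reindex_apply] at hi
  rw [Module.Basis.reindex_apply]
  simpa [b] using hx' (Finsupp.mem_support_iff.mpr hi')

/-! ### Entry times in filtrations -/

/-- A filtration of a vector space by the real line that is right-continuous and starts at `0`. -/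
structure IsTame {𝕜 : Type v} [Field 𝕜] {V : Type w} [AddCommGroup V] [Module 𝕜 V]
    (Φ : ℝ → Submodule 𝕜 V) : Prop where
  mono : Monotone Φ
  right : ∀ ε, ∃ δ > ε, Φ δ ≤ Φ ε
  bot : ∃ ε, Φ ε = ⊥

open Classical in
/-- The least parameter at which a vector appears in a filtration. -/
noncomputable def level {𝕜 : Type v} [Field 𝕜] {V : Type w} [AddCommGroup V] [Module 𝕜 V]
    (Φ : ℝ → Submodule 𝕜 V) (x : V) : WithTop ℝ :=
  if ∃ ε, x ∈ Φ ε then ((sInf {ε | x ∈ Φ ε} : ℝ) : WithTop ℝ) else ⊤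

/-- Right continuity makes the infimum attained, and vanishing at some parameter bounds it below.
The zero vector lies in every stage, so its `sInf` is meaningless. -/
theorem IsTame.mem_iff {𝕜 : Type v} [Field 𝕜] {V : Type w} [AddCommGroup V] [Module 𝕜 V]
    {Φ : ℝ → Submodule 𝕜 V} (h : IsTame Φ) {x : V} (hx : x ≠ 0) (ε : ℝ) :
    x ∈ Φ ε ↔ level Φ x ≤ ε := by
  obtain ⟨m, hm⟩ := h.bot
  have hbdd : BddBelow {ε | x ∈ Φ ε} := by
    refine ⟨m, fun ε hε => ?_⟩
    by_contra! hlt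
    have : x ∈ Φ m := h.mono hlt.le hε
    rw [hm, Submodule.mem_bot] at this
    exact hx this
  unfold level
  split_ifs with hex
  · rw [WithTop.coe_le_coe]
    refine ⟨fun hε => csInf_le hbdd hε, fun hε => h.mono hε ?_⟩
    obtain ⟨δ, hδ, hδle⟩ := h.right (sInf {ε | x ∈ Φ ε})
    obtain ⟨e, he, heδ⟩ := exists_lt_of_csInf_lt hex hδ
    exact hδle (h.mono heδ.le he)
  · simp only [top_le_iff, WithTop.coe_ne_top, iff_false]
    exact fun hε => hex ⟨ε, hε⟩

theorem IsTame.level_le_add {𝕜 : Type v} [Field 𝕜] {V : Type w} [AddCommGroup V] [Module 𝕜 V]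
    {Φ Ψ : ℝ → Submodule 𝕜 V} (hΦ : IsTame Φ) (hΨ : IsTame Ψ) {η : ℝ}
    (h : ∀ ε, Φ ε ≤ Ψ (ε + η)) {x : V} (hx : x ≠ 0) : level Ψ x ≤ level Φ x + η := by
  cases hl : level Φ x with
  | top => simp
  | coe ε =>
    have := h ε ((hΦ.mem_iff hx ε).mpr hl.le)
    rwa [hΨ.mem_iff hx] at this

/-- The interval `[level Z x, level B x)` as a point of a diagram. -/
noncomputable def levelPoint {𝕜 : Type v} [Field 𝕜] {V : Type w} [AddCommGroup V] [Module 𝕜 V]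
    (Z B : ℝ → Submodule 𝕜 V) (x : V) : DiagramPoint where
  -- The default `0` occurs only for vectors in no `Z ε`, which `levelDiagram` leaves out.
  birth := (level Z x).untopD 0
  -- The maximum yields a valid point without assuming `B ε ≤ Z ε`; a vector entering `B` no later
  -- than `Z` gives a diagonal point.
  death := max ((level Z x).untopD 0 : ℝ) (level B x)
  birth_le_death := le_max_left _ _

theorem coe_birth_levelPoint {𝕜 : Type v} [Field 𝕜] {V : Type w} [AddCommGroup V] [Module 𝕜 V]
    {Z : ℝ → Submodule 𝕜 V} (B : ℝ → Submodule 𝕜 V) {x : V} (h : level Z x ≠ ⊤) :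
    ((levelPoint Z B x).birth : WithTop ℝ) = level Z x := by
  lift level Z x to ℝ using h with b hb
  simp [levelPoint, ← hb]

/-- The point does not lie on the diagonal. -/
def DiagramPoint.IsProper (P : DiagramPoint) : Prop :=
  (P.birth : WithTop ℝ) < P.death

theorem mem_interval_levelPoint {𝕜 : Type v} [Field 𝕜] {V : Type w} [AddCommGroup V] [Module 𝕜 V]
    {Z B : ℝ → Submodule 𝕜 V} (hZ : IsTame Z) (hB : IsTame B) {x : V} (hx : x ≠ 0)
    (h : level Z x ≠ ⊤) (ε : ℝ) :
    ε ∈ (levelPoint Z B x).interval ↔ x ∈ Z ε ∧ x ∉ B ε := by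
  rw [hZ.mem_iff hx, hB.mem_iff hx, ← coe_birth_levelPoint B h, WithTop.coe_le_coe, not_le]
  refine and_congr_right fun hb => ?_
  change (ε : WithTop ℝ) < max ((levelPoint Z B x).birth : WithTop ℝ) (level B x) ↔ _
  rw [lt_max_iff, or_iff_right]
  simpa using hb

theorem isProper_levelPoint {𝕜 : Type v} [Field 𝕜] {V : Type w} [AddCommGroup V] [Module 𝕜 V]
    {Z B : ℝ → Submodule 𝕜 V} (hZ : IsTame Z) (hB : IsTame B) {x : V} (hx : x ≠ 0)
    {ε : ℝ} (h₁ : x ∈ Z ε) (h₂ : x ∉ B ε) :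
    level Z x ≠ ⊤ ∧ (levelPoint Z B x).IsProper := by
  have h : level Z x ≠ ⊤ :=
    ne_top_of_le_ne_top WithTop.coe_ne_top ((hZ.mem_iff hx ε).mp h₁)
  have hI := (mem_interval_levelPoint hZ hB hx h ε).mpr ⟨h₁, h₂⟩
  exact ⟨h, lt_of_le_of_lt (WithTop.coe_le_coe.mpr hI.1) hI.2⟩

/-! ### Barcodes from adapted bases -/

/-- The persistence module of the subquotients `Z ε / B ε`. -/
def subquotientModule {𝕜 : Type v} [Field 𝕜] {V : Type w} [AddCommGroup V] [Module 𝕜 V]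
    {Z B : ℝ → Submodule 𝕜 V} (hZ : Monotone Z) (hB : Monotone B) : PersistenceModule.{v, w} 𝕜 where
  space ε := Subquotient (Z ε) (B ε)
  map h := subquotientInclusion (hZ h) (hB h)
  map_refl _ x := Submodule.Quotient.induction_on _ x fun _ => rfl
  map_trans _ _ x := Submodule.Quotient.induction_on _ x fun _ => rfl

open Classical in
/-- The coordinates of a vector, as elements of interval modules. -/
noncomputable def intervalCoord {𝕜 : Type v} [Field 𝕜] {V : Type w} [AddCommGroup V] [Module 𝕜 V]
    {ι A : Type} (β : Module.Basis ι 𝕜 V) (f : A → ι) (P : A → DiagramPoint)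
    (U : Submodule 𝕜 V) (ε : ℝ) : U →ₗ[𝕜] ∀ a, intervalSpace 𝕜 (P a) ε where
  toFun x a := ⟨if ε ∈ (P a).interval then β.repr x (f a) else 0, fun h => if_neg h⟩
  map_add' x y := by
    ext a
    by_cases h : ε ∈ (P a).interval <;> simp [h]
  map_smul' c x := by
    ext a
    by_cases h : ε ∈ (P a).interval <;> simp [h]

theorem map_univ_subtype_val {ι : Type*} {γ : Type*} [Fintype ι] (p : ι → Prop) [DecidablePred p]
    (f : ι → γ) :
    (Finset.univ : Finset {i // p i}).val.map (fun i : {i // p i} => f i) =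
      (Finset.univ.filter p).val.map f := by
  have h : Finset.univ.map (Function.Embedding.subtype p) = Finset.univ.filter p := by
    ext; simp
  rw [← h, Finset.map_val, Multiset.map_map]
  rfl

open Classical in
/-- The diagram of `Z ε / B ε`, with additional points on the diagonal. -/
noncomputable def levelDiagram {𝕜 : Type v} [Field 𝕜] {V : Type w} [AddCommGroup V] [Module 𝕜 V]
    {n : ℕ} (β : Module.Basis (Fin n) 𝕜 V) (Z B : ℝ → Submodule 𝕜 V) : PersistenceDiagram :=
  (Finset.univ.filter fun i => level Z (β i) ≠ ⊤).val.map fun i => levelPoint Z B (β i)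

-- A basis vector contributes at `ε` exactly when it lies in `Z ε` but not in `B ε`. Adaptedness
-- makes these coordinates a surjection from `Z ε` with kernel the part of `B ε` in `Z ε`.
open Classical in
theorem isBarcode_subquotientModule {𝕜 : Type v} [Field 𝕜] {V : Type w} [AddCommGroup V]
    [Module 𝕜 V] {n : ℕ} (β : Module.Basis (Fin n) 𝕜 V) {Z B : ℝ → Submodule 𝕜 V}
    (hZ : IsTame Z) (hB : IsTame B)
    (hβZ : ∀ ε, β.IsAdapted (Z ε)) (hβB : ∀ ε, β.IsAdapted (B ε)) :
    IsBarcode (subquotientModule hZ.mono hB.mono)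
      ((levelDiagram β Z B).filter DiagramPoint.IsProper) := by
  let p : Fin n → Prop := fun i => level Z (β i) ≠ ⊤ ∧ (levelPoint Z B (β i)).IsProper
  let A := {i // p i}
  let P : A → DiagramPoint := fun a => levelPoint Z B (β a)
  have hI : ∀ (a : A) (ε : ℝ), ε ∈ (P a).interval ↔ β a ∈ Z ε ∧ β a ∉ B ε := fun a ε =>
    mem_interval_levelPoint hZ hB (β.ne_zero _) a.2.1 ε
  let f : ∀ ε, Z ε →ₗ[𝕜] ∀ a, intervalSpace 𝕜 (P a) ε := fun ε =>
    intervalCoord β Subtype.val P (Z ε) ε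
  have hf : ∀ ε (x : Z ε) a, (f ε x a : 𝕜) = if ε ∈ (P a).interval then β.repr x a else 0 :=
    fun _ _ _ => rfl
  have hker : ∀ ε, LinearMap.ker (f ε) = (B ε).submoduleOf (Z ε) := by
    intro ε
    ext x
    rw [LinearMap.mem_ker, Submodule.submoduleOf, Submodule.mem_comap, Submodule.subtype_apply]
    constructor
    · intro hx
      rw [← β.sum_repr (x : V)]
      refine Submodule.sum_mem _ fun i _ => ?_
      by_cases hi : β.repr (x : V) i = 0
      · simp [hi]
      refine Submodule.smul_mem _ _ ?_
      by_contra hiB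
      have hiZ := hβZ ε x x.2 i hi
      let a : A := ⟨i, isProper_levelPoint hZ hB (β.ne_zero _) hiZ hiB⟩
      have := hf ε x a
      rw [if_pos ((hI a ε).mpr ⟨hiZ, hiB⟩), hx] at this
      exact hi this.symm
    · intro hx
      ext a
      rw [hf]
      split_ifs with ha
      · by_contra hne
        exact ((hI a ε).mp ha).2 (hβB ε x hx a hne)
      · rfl
  have hsurj : ∀ ε, Function.Surjective (f ε) := by
    intro ε y
    refine ⟨⟨∑ a : A, (y a : 𝕜) • β a, Submodule.sum_mem _ fun a _ => ?_⟩, ?_⟩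
    · by_cases ha : ε ∈ (P a).interval
      · exact Submodule.smul_mem _ _ ((hI a ε).mp ha).1
      · rw [(y a).2 ha, zero_smul]
        exact zero_mem _
    · ext a
      rw [hf]
      split_ifs with ha
      · simp only [map_sum, map_smul, Module.Basis.repr_self, Finsupp.coe_finsetSum,
          Finset.sum_apply, Finsupp.smul_apply, smul_eq_mul]
        rw [Finset.sum_eq_single a]
        · simp
        · intro b _ hb
          rw [Finsupp.single_eq_of_ne, mul_zero]
          exact fun h => hb (Subtype.ext h.symm)
        · simp
      · exact ((y a).2 ha).symm
  refine ⟨A, inferInstance, P, ?_, fun a => a.2.2, ⟨⟨fun ε => ?_, ?_⟩⟩⟩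
  · rw [levelDiagram, Multiset.filter_map, ← Finset.filter_val, Finset.filter_filter]
    exact map_univ_subtype_val p fun i => levelPoint Z B (β i)
  · exact (Submodule.quotEquivOfEq _ _ (hker ε).symm).trans
      ((f ε).quotKerEquivOfSurjective (hsurj ε))
  · intro s t hst x
    refine Submodule.Quotient.induction_on _ x fun z => ?_
    change f t (Submodule.inclusion (hZ.mono hst) z) = fun a => intervalMap 𝕜 (P a) s t (f s z a)
    ext a
    rw [hf]
    change _ = if t ∈ (P a).interval then (f s z a : 𝕜) else 0
    rw [hf]
    split_ifs with ht hs
    · rfl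
    -- A nonzero coordinate puts `β a` in `Z s`, and `β a ∉ B t` forces `β a ∉ B s`; hence `s` is in
    -- the interval after all.
    · by_contra hne
      refine hs ((hI a s).mpr ⟨hβZ s z z.2 a hne, fun h => ?_⟩)
      exact ((hI a t).mp ht).2 (hB.mono hst h)
    · rfl

/-! ### Uniqueness of barcodes from ranks -/

/-- The parameter is so late that an interval containing it, with death in `S`, cannot die before
`P`. -/
theorem DiagramPoint.exists_mem_interval {P : DiagramPoint} (hP : P.IsProper) (S : Finset ℝ) :
    ∃ t ∈ P.interval, P.birth ≤ t ∧ ∀ d ∈ S, (d : WithTop ℝ) < P.death → d ≤ t := by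
  classical
  let S' : Finset ℝ := insert P.birth (S.filter fun d : ℝ => (d : WithTop ℝ) < P.death)
  have hne : S'.Nonempty := Finset.insert_nonempty _ _
  have hmem : (S'.max' hne : WithTop ℝ) < P.death := by
    have h : S'.max' hne = P.birth ∨ S'.max' hne ∈ S.filter fun d : ℝ => (d : WithTop ℝ) < P.death :=
      Finset.mem_insert.mp (S'.max'_mem hne)
    rcases h with h | h
    · rw [h]
      exact hP
    · exact (Finset.mem_filter.mp h).2
  have hb : P.birth ≤ S'.max' hne := S'.le_max' _ (Finset.mem_insert_self _ _)
  exact ⟨S'.max' hne, ⟨hb, hmem⟩, hb, fun d hd hlt =>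
    S'.le_max' _ (Finset.mem_insert_of_mem (Finset.mem_filter.mpr ⟨hd, hlt⟩))⟩

/-- A nonempty diagram has a point of least birth, and of greatest death among those. -/
theorem exists_extremal_point {D : PersistenceDiagram} (hD : D ≠ 0) :
    ∃ P ∈ D, ∀ Q ∈ D, Q.birth ≤ P.birth → P.death ≤ Q.death → Q = P := by
  induction D using Multiset.induction with
  | empty => exact absurd rfl hD
  | cons R D ih =>
    by_cases h0 : D = 0
    · subst h0
      exact ⟨R, by simp, by simp⟩
    obtain ⟨P, hP, hPD⟩ := ih h0
    by_cases hR : R.birth ≤ P.birth ∧ P.death ≤ R.death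
    · refine ⟨R, by simp, fun Q hQ h₁ h₂ => ?_⟩
      rcases Multiset.mem_cons.mp hQ with rfl | hQ
      · rfl
      · obtain rfl := hPD Q hQ (h₁.trans hR.1) (hR.2.trans h₂)
        exact DiagramPoint.ext (le_antisymm h₁ hR.1) (le_antisymm hR.2 h₂)
    · refine ⟨P, by simp [hP], fun Q hQ h₁ h₂ => ?_⟩
      rcases Multiset.mem_cons.mp hQ with rfl | hQ
      · exact absurd ⟨h₁, h₂⟩ hR
      · exact hPD Q hQ h₁ h₂

open Classical in
/-- The number of the intervals of a diagram that contain both `s` and `t`. -/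
noncomputable def rankCount (D : PersistenceDiagram) (s t : ℝ) : ℕ :=
  D.countP fun P => s ∈ P.interval ∧ t ∈ P.interval

/-- An extremal point of one diagram belongs to each diagram with the same ranks. -/
theorem mem_of_rankCount_eq {D E : PersistenceDiagram}
    (h : ∀ s t, s ≤ t → rankCount D s t = rankCount E s t) {P : DiagramPoint} (hPD : P ∈ D)
    (hP : P.IsProper)
    (hmax : ∀ Q ∈ E, Q.birth ≤ P.birth → P.death ≤ Q.death → Q = P) : P ∈ E := by
  classical
  -- Any interval of `E` containing both `P.birth` and `t` reaches at least as far as `P` on both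
  -- sides. Infinite deaths enter the finite set as a harmless `0`.
  obtain ⟨t, ht, hbt, hd⟩ := DiagramPoint.exists_mem_interval hP
    ((E.map fun Q => Q.death.untopD 0).toFinset)
  have hpos : 0 < rankCount D P.birth t :=
    Multiset.countP_pos.mpr ⟨P, hPD, ⟨le_rfl, hP⟩, ht⟩
  rw [h _ _ hbt] at hpos
  obtain ⟨Q, hQ, hQb, hQt⟩ := Multiset.countP_pos.mp hpos
  rw [← hmax Q hQ hQb.1]
  · exact hQ
  · by_contra! hlt
    have hQd : ((Q.death.untopD 0 : ℝ) : WithTop ℝ) = Q.death := by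
      lift Q.death to ℝ using (hlt.trans_le le_top).ne with d
      rfl
    have := hd (Q.death.untopD 0) (by simp only [Multiset.mem_toFinset, Multiset.mem_map]; exact ⟨Q, hQ, rfl⟩)
      (by rwa [hQd])
    rw [← WithTop.coe_le_coe, hQd] at this
    exact absurd hQt.2 this.not_gt

/-- A point extremal in `D + E` is extremal for both diagrams, so it belongs to both. Removing it
lowers both rank counts equally. -/
theorem eq_of_rankCount_eq {D E : PersistenceDiagram} (hD : ∀ P ∈ D, P.IsProper)
    (hE : ∀ P ∈ E, P.IsProper) (h : ∀ s t, s ≤ t → rankCount D s t = rankCount E s t) :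
    D = E := by
  classical
  induction hn : D.card using Nat.strong_induction_on generalizing D E with
  | _ n ih =>
  by_cases h0 : D + E = 0
  · obtain ⟨rfl, rfl⟩ := add_eq_zero.mp h0
    rfl
  obtain ⟨P, hP, hext⟩ := exists_extremal_point h0
  have hPDE : P ∈ D ∧ P ∈ E := by
    rcases Multiset.mem_add.mp hP with hPD | hPE
    · exact ⟨hPD, mem_of_rankCount_eq h hPD (hD P hPD) fun Q hQ =>
        hext Q (Multiset.mem_add.mpr (Or.inr hQ))⟩
    · exact ⟨mem_of_rankCount_eq (fun s t hst => (h s t hst).symm) hPE (hE P hPE) fun Q hQ =>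
        hext Q (Multiset.mem_add.mpr (Or.inl hQ)), hPE⟩
  obtain ⟨D, rfl⟩ := Multiset.exists_cons_of_mem hPDE.1
  obtain ⟨E, rfl⟩ := Multiset.exists_cons_of_mem hPDE.2
  congr 1
  refine ih D.card ?_ (fun Q hQ => hD Q (Multiset.mem_cons_of_mem hQ))
    (fun Q hQ => hE Q (Multiset.mem_cons_of_mem hQ)) (fun s t hst => ?_) rfl
  · rw [← hn, Multiset.card_cons]
    exact Nat.lt_succ_self _
  · have := h s t hst
    simpa [rankCount, Multiset.countP_cons] using this

-- The range is the coordinate subspace of the intervals containing both parameters; `φ`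
-- parametrizes it.
open Classical in
theorem finrank_range_map_finiteSum {𝕜 : Type v} [Field 𝕜] {A : Type} [Fintype A]
    (P : A → DiagramPoint) {s t : ℝ} (hst : s ≤ t) :
    Module.finrank 𝕜
      (LinearMap.range ((PersistenceModule.finiteSum fun a => intervalModule 𝕜 (P a)).map hst)) =
      rankCount ((Finset.univ : Finset A).val.map P) s t := by
  let p : A → Prop := fun a => s ∈ (P a).interval ∧ t ∈ (P a).interval
  let g : (∀ a, intervalSpace 𝕜 (P a) s) →ₗ[𝕜] (∀ a, intervalSpace 𝕜 (P a) t) :=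
    LinearMap.pi fun a => intervalMap 𝕜 (P a) s t ∘ₗ LinearMap.proj a
  let φ : ({a // p a} → 𝕜) →ₗ[𝕜] (∀ a, intervalSpace 𝕜 (P a) t) :=
    { toFun := fun y a => ⟨if h : p a then y ⟨a, h⟩ else 0, fun h => dif_neg fun h' => h h'.2⟩
      map_add' := fun x y => by
        ext a
        by_cases h : p a <;> simp [h]
      map_smul' := fun c x => by
        ext a
        by_cases h : p a <;> simp [h] }
  have hφ : ∀ y a, (φ y a : 𝕜) = if h : p a then y ⟨a, h⟩ else 0 := fun _ _ => rfl
  have hg : ∀ x a, (g x a : 𝕜) = if t ∈ (P a).interval then (x a : 𝕜) else 0 := fun _ _ => rfl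
  have hinj : Function.Injective φ := by
    intro y z hyz
    ext a
    have := congrArg (fun w => (w a.1 : 𝕜)) hyz
    simpa [hφ, a.2] using this
  have hrange : LinearMap.range g = LinearMap.range φ := by
    ext w
    constructor
    · rintro ⟨x, rfl⟩
      refine ⟨fun a => x a, ?_⟩
      ext a
      refine (hφ _ a).trans (Eq.trans ?_ (hg x a).symm)
      by_cases hs : s ∈ (P a).interval
      · by_cases ht : t ∈ (P a).interval <;> simp [p, hs, ht]
      · simp [p, hs, (x a).2 hs]
    · rintro ⟨y, rfl⟩
      refine ⟨fun a => ⟨if h : p a then y ⟨a, h⟩ else 0, fun h => dif_neg fun h' => h h'.1⟩, ?_⟩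
      ext a
      refine (hg _ a).trans (Eq.trans ?_ (hφ y a).symm)
      by_cases hs : s ∈ (P a).interval <;> by_cases ht : t ∈ (P a).interval <;> simp [p, hs, ht]
  change Module.finrank 𝕜 (LinearMap.range g) = _
  rw [hrange, LinearMap.finrank_range_of_inj hinj, Module.finrank_fintype_fun_eq_card,
    Fintype.card_subtype, rankCount, Multiset.countP_map]
  rfl

theorem finrank_range_map_of_iso {𝕜 : Type v} [Field 𝕜] {M : PersistenceModule.{v, u} 𝕜}
    {N : PersistenceModule.{v, w} 𝕜} (e : M.Iso N) {s t : ℝ} (hst : s ≤ t) :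
    Module.finrank 𝕜 (LinearMap.range (M.map hst)) =
      Module.finrank 𝕜 (LinearMap.range (N.map hst)) := by
  have h : (LinearMap.range (M.map hst)).map (e.equiv t).toLinearMap =
      LinearMap.range (N.map hst) := by
    ext y
    constructor
    · rintro ⟨_, ⟨x, rfl⟩, rfl⟩
      exact ⟨e.equiv s x, (e.comm hst x).symm⟩
    · rintro ⟨x, rfl⟩
      refine ⟨_, ⟨(e.equiv s).symm x, rfl⟩, ?_⟩
      simpa using e.comm hst ((e.equiv s).symm x)
  rw [← h]
  exact ((e.equiv t).submoduleMap _).finrank_eq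

theorem IsBarcode.finrank_range_map {𝕜 : Type v} [Field 𝕜] {M : PersistenceModule.{v, w} 𝕜}
    {D : PersistenceDiagram} (h : IsBarcode M D) {s t : ℝ} (hst : s ≤ t) :
    Module.finrank 𝕜 (LinearMap.range (M.map hst)) = rankCount D s t := by
  obtain ⟨A, _, P, rfl, -, ⟨e⟩⟩ := h
  rw [finrank_range_map_of_iso e, finrank_range_map_finiteSum]

theorem IsBarcode.isProper {𝕜 : Type v} [Field 𝕜] {M : PersistenceModule.{v, w} 𝕜}
    {D : PersistenceDiagram} (h : IsBarcode M D) : ∀ P ∈ D, P.IsProper := by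
  obtain ⟨A, _, P, rfl, hP, -⟩ := h
  intro Q hQ
  obtain ⟨a, -, rfl⟩ := Multiset.mem_map.mp hQ
  exact hP a

theorem IsBarcode.unique {𝕜 : Type v} [Field 𝕜] {M : PersistenceModule.{v, w} 𝕜}
    {D E : PersistenceDiagram} (hD : IsBarcode M D) (hE : IsBarcode M E) : D = E :=
  eq_of_rankCount_eq hD.isProper hE.isProper fun _ _ hst =>
    (hD.finrank_range_map hst).symm.trans (hE.finrank_range_map hst)

/-- The composition of isomorphisms of persistence modules. -/
def PersistenceModule.Iso.trans {𝕜 : Type v} [Field 𝕜] {L : PersistenceModule.{v, u} 𝕜}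
    {M : PersistenceModule.{v, u} 𝕜} {N : PersistenceModule.{v, w} 𝕜} (e : L.Iso M)
    (f : M.Iso N) : L.Iso N where
  equiv s := (e.equiv s).trans (f.equiv s)
  comm h x := by
    rw [LinearEquiv.trans_apply, LinearEquiv.trans_apply, e.comm, f.comm]

theorem IsBarcode.of_iso {𝕜 : Type v} [Field 𝕜] {M N : PersistenceModule.{v, w} 𝕜}
    (e : M.Iso N) {D : PersistenceDiagram} (h : IsBarcode N D) : IsBarcode M D := by
  obtain ⟨A, i, P, hPD, hP, ⟨f⟩⟩ := h
  exact ⟨A, i, P, hPD, hP, ⟨e.trans f⟩⟩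

/-! ### Matchings and the bottleneck distance -/

theorem deathDist_self (x : WithTop ℝ) : deathDist x x = 0 := by
  cases x with
  | top => rfl
  | coe x => exact show ENNReal.ofReal |x - x| = 0 by simp

/-- The additive form is the one that entry times satisfy; it respects infinity because `⊤ ≤ y + η`
forces `y = ⊤`. -/
theorem deathDist_le_ofReal_iff {x y : WithTop ℝ} {η : ℝ} (hη : 0 ≤ η) :
    deathDist x y ≤ ENNReal.ofReal η ↔ x ≤ y + η ∧ y ≤ x + η := by
  cases x with
  | top =>
    cases y with
    | top => exact iff_of_true (by simp [deathDist_self]) (by simp)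
    | coe y =>
      refine iff_of_false ?_ fun h => ?_
      · exact show ¬ (⊤ : ENNReal) ≤ _ by simp
      · have := h.1
        rw [← WithTop.coe_add, top_le_iff] at this
        exact WithTop.coe_ne_top this
  | coe x =>
    cases y with
    | top =>
      refine iff_of_false ?_ fun h => ?_
      · exact show ¬ (⊤ : ENNReal) ≤ _ by simp
      · have := h.2
        rw [← WithTop.coe_add, top_le_iff] at this
        exact WithTop.coe_ne_top this
    | coe y =>
      change ENNReal.ofReal |x - y| ≤ _ ↔ _
      rw [ENNReal.ofReal_le_ofReal_iff hη, ← WithTop.coe_add, ← WithTop.coe_add,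
        WithTop.coe_le_coe, WithTop.coe_le_coe, abs_le]
      constructor <;> rintro ⟨h₁, h₂⟩ <;> constructor <;> linarith

theorem DiagramPoint.supDist_le_ofReal_iff {P Q : DiagramPoint} {η : ℝ} (hη : 0 ≤ η) :
    P.supDist Q ≤ ENNReal.ofReal η ↔
      |P.birth - Q.birth| ≤ η ∧ P.death ≤ Q.death + η ∧ Q.death ≤ P.death + η := by
  rw [supDist, max_le_iff, deathDist_le_ofReal_iff hη, ENNReal.ofReal_le_ofReal_iff hη]

theorem DiagramPoint.supDist_triangle {P Q R : DiagramPoint} {η θ : ℝ} (hη : 0 ≤ η) (hθ : 0 ≤ θ)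
    (h₁ : P.supDist Q ≤ ENNReal.ofReal η) (h₂ : Q.supDist R ≤ ENNReal.ofReal θ) :
    P.supDist R ≤ ENNReal.ofReal (η + θ) := by
  rw [supDist_le_ofReal_iff hη] at h₁
  rw [supDist_le_ofReal_iff hθ] at h₂
  rw [supDist_le_ofReal_iff (add_nonneg hη hθ)]
  refine ⟨(abs_sub_le _ Q.birth _).trans (add_le_add h₁.1 h₂.1), ?_, ?_⟩
  · calc P.death ≤ Q.death + η := h₁.2.1
      _ ≤ R.death + θ + η := by gcongr; exact h₂.2.1
      _ = R.death + (η + θ : ℝ) := by rw [add_assoc, WithTop.coe_add, add_comm (θ : WithTop ℝ)]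
  · calc R.death ≤ Q.death + θ := h₂.2.2
      _ ≤ P.death + η + θ := by gcongr; exact h₁.2.2
      _ = P.death + (η + θ : ℝ) := by rw [add_assoc, WithTop.coe_add]

theorem DiagramPoint.supDist_self (P : DiagramPoint) : P.supDist P = 0 := by
  simp [supDist, deathDist_self]

theorem DiagramPoint.supDist_comm (P Q : DiagramPoint) : P.supDist Q = Q.supDist P := by
  have h : ∀ x y : WithTop ℝ, deathDist x y = deathDist y x := by
    rintro (_ | x) (_ | y)
    · rfl
    · rfl
    · rfl
    · exact congrArg ENNReal.ofReal (abs_sub_comm x y)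
  rw [supDist, supDist, abs_sub_comm, h]

/-- A point that is close to the diagonal has small persistence. -/
theorem DiagramPoint.pers_half_le {P Q : DiagramPoint} {η : ℝ} (hη : 0 ≤ η)
    (h : P.supDist Q ≤ ENNReal.ofReal η) (hQ : ¬ Q.IsProper) : P.pers / 2 ≤ ENNReal.ofReal η := by
  rw [supDist_le_ofReal_iff hη] at h
  have hQd : Q.death = Q.birth := le_antisymm (not_lt.mp hQ) Q.birth_le_death
  -- Both coordinates of `P` are within `η` of the common coordinate of `Q`.
  have h₂ : P.pers ≤ ENNReal.ofReal (2 * η) := by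
    rw [pers, deathDist_le_ofReal_iff (by positivity)]
    constructor
    · refine h.2.1.trans ?_
      rw [hQd, ← WithTop.coe_add, ← WithTop.coe_add, WithTop.coe_le_coe]
      linarith [(abs_le.mp h.1).1]
    · exact P.birth_le_death.trans (le_add_of_nonneg_right (by exact_mod_cast (by positivity : 0 ≤ 2 * η)))
  refine ENNReal.div_le_of_le_mul (h₂.trans ?_)
  rw [mul_comm, ENNReal.ofReal_mul hη]
  simp

/-- Two diagrams that can be matched within `η`, after points on the diagonal have been added. -/
def DiagramClose (η : ℝ) (D₁ D₂ : PersistenceDiagram) : Prop :=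
  ∃ E₁ E₂ : PersistenceDiagram, (∀ P ∈ E₁, ¬ P.IsProper) ∧ (∀ P ∈ E₂, ¬ P.IsProper) ∧
    Multiset.Rel (fun P Q => P.supDist Q ≤ ENNReal.ofReal η) (D₁ + E₁) (D₂ + E₂)

theorem Multiset.Rel.comp {α β γ : Type*} {r : α → β → Prop} {p : β → γ → Prop} {q : α → γ → Prop}
    (hq : ∀ a b c, r a b → p b c → q a c) {s : Multiset α} {t : Multiset β} {u : Multiset γ}
    (h₁ : Multiset.Rel r s t) (h₂ : Multiset.Rel p t u) : Multiset.Rel q s u := by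
  induction h₁ generalizing u with
  | zero =>
    rw [Multiset.rel_zero_left.mp h₂]
    exact Multiset.Rel.zero
  | cons hab _ ih =>
    obtain ⟨c, u', hc, hu, rfl⟩ := Multiset.rel_cons_left.mp h₂
    exact Multiset.Rel.cons (hq _ _ _ hab hc) (ih hu)

theorem DiagramClose.trans {η θ : ℝ} (hη : 0 ≤ η) (hθ : 0 ≤ θ) {D₁ D₂ D₃ : PersistenceDiagram}
    (h₁ : DiagramClose η D₁ D₂) (h₂ : DiagramClose θ D₂ D₃) : DiagramClose (η + θ) D₁ D₃ := by
  obtain ⟨E₁, E₂, hE₁, hE₂, hr⟩ := h₁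
  obtain ⟨F₂, F₃, hF₂, hF₃, hs⟩ := h₂
  -- Each matching carries the other's diagonal points at `D₂` along unchanged, so that both pass
  -- through `D₂ + E₂ + F₂`.
  refine ⟨E₁ + F₂, F₃ + E₂, ?_, ?_, ?_⟩
  · intro P hP
    exact (Multiset.mem_add.mp hP).elim (hE₁ P) (hF₂ P)
  · intro P hP
    exact (Multiset.mem_add.mp hP).elim (hF₃ P) (hE₂ P)
  have hrefl : ∀ (ζ : ℝ) (E : PersistenceDiagram),
      Multiset.Rel (fun P Q => P.supDist Q ≤ ENNReal.ofReal ζ) E E := fun ζ E =>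
    Multiset.rel_refl_of_refl_on fun P _ => by simp [P.supDist_self]
  have hr' := hr.add (hrefl η F₂)
  have hs' := hs.add (hrefl θ E₂)
  rw [add_right_comm D₂ F₂ E₂, add_assoc D₃] at hs'
  rw [add_assoc D₁] at hr'
  refine Multiset.Rel.comp ?_ hr' hs'
  intro P Q R h h'
  exact DiagramPoint.supDist_triangle hη hθ h h'

theorem Multiset.Rel.exists_pairs {α β : Type*} {r : α → β → Prop} {s : Multiset α}
    {t : Multiset β} (h : Multiset.Rel r s t) :
    ∃ M : Multiset (α × β), M.map Prod.fst = s ∧ M.map Prod.snd = t ∧ ∀ p ∈ M, r p.1 p.2 := by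
  induction h with
  | zero => exact ⟨0, by simp⟩
  | @cons a b _ _ hab _ ih =>
    obtain ⟨M, rfl, rfl, hM⟩ := ih
    refine ⟨(a, b) ::ₘ M, by simp, by simp, fun p hp => ?_⟩
    rcases Multiset.mem_cons.mp hp with rfl | hp
    · exact hab
    · exact hM p hp

theorem Multiset.Rel.exists_left {α β : Type*} {r : α → β → Prop} {s : Multiset α}
    {t : Multiset β} (h : Multiset.Rel r s t) {b : β} (hb : b ∈ t) : ∃ a ∈ s, r a b :=
  Multiset.exists_mem_of_rel_of_mem (Multiset.rel_flip.mpr h) hb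

/-- Pairs of genuine points stay matched. A genuine point paired with a diagonal one becomes
unmatched, which costs at most `η` by `DiagramPoint.pers_half_le`. -/
theorem DiagramClose.bottleneckDist_le {η : ℝ} (hη : 0 ≤ η) {D₁ D₂ : PersistenceDiagram}
    (h : DiagramClose η D₁ D₂) : bottleneckDist D₁ D₂ ≤ ENNReal.ofReal η := by
  obtain ⟨E₁, E₂, hE₁, hE₂, hr⟩ := h
  classical
  -- `A` is paired with `D₂` and `B` with `E₂`; the part `D₁ ∩ A` of `A` is genuine and the rest is
  -- diagonal.
  obtain ⟨A, B, hA, hB, hAB⟩ := Multiset.rel_add_right.mp hr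
  have hAD : A = D₁ ∩ A + (A - D₁) := by
    rw [Multiset.inter_comm, add_comm, Multiset.sub_add_inter]
  have hsubB : D₁ - A ≤ B := tsub_le_iff_left.mpr (hAB ▸ Multiset.le_add_right _ _)
  have hsubE : A - D₁ ≤ E₁ := tsub_le_iff_left.mpr (hAB ▸ Multiset.le_add_right _ _)
  rw [hAD] at hA
  obtain ⟨U, W, hU, hW, rfl⟩ := Multiset.rel_add_left.mp hA
  obtain ⟨M, hM₁, hM₂, hM⟩ := hU.exists_pairs
  refine (iInf₂_le M (D₁ - A)).trans ((iInf₂_le W ?_).trans ((iInf_le _ ?_).trans ?_))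
  · rw [hM₁, add_comm, Multiset.sub_add_inter]
  · rw [hM₂]
  refine max_le (iSup₂_le hM) (max_le (iSup₂_le fun P hP => ?_) (iSup₂_le fun Q hQ => ?_))
  · obtain ⟨Q, hQ, hPQ⟩ := Multiset.exists_mem_of_rel_of_mem hB (Multiset.mem_of_le hsubB hP)
    exact DiagramPoint.pers_half_le hη hPQ (hE₂ Q hQ)
  · obtain ⟨P, hP, hPQ⟩ := hW.exists_left hQ
    rw [DiagramPoint.supDist_comm] at hPQ
    exact DiagramPoint.pers_half_le hη hPQ (hE₁ P (Multiset.mem_of_le hsubE hP))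

theorem supDist_levelPoint_le {𝕜 : Type v} [Field 𝕜] {V : Type w} [AddCommGroup V] [Module 𝕜 V]
    {Z B Z' B' : ℝ → Submodule 𝕜 V} (hZ : IsTame Z) (hB : IsTame B) (hZ' : IsTame Z')
    (hB' : IsTame B') {η : ℝ} (hη : 0 ≤ η) (h₁ : ∀ ε, Z ε ≤ Z' (ε + η))
    (h₂ : ∀ ε, Z' ε ≤ Z (ε + η)) (h₃ : ∀ ε, B ε ≤ B' (ε + η)) (h₄ : ∀ ε, B' ε ≤ B (ε + η))
    {x : V} (hx : x ≠ 0) (hl : level Z x ≠ ⊤) (hl' : level Z' x ≠ ⊤) :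
    (levelPoint Z B x).supDist (levelPoint Z' B' x) ≤ ENNReal.ofReal η := by
  have hb₁ := hZ.level_le_add hZ' h₁ hx
  have hb₂ := hZ'.level_le_add hZ h₂ hx
  rw [← coe_birth_levelPoint B hl, ← coe_birth_levelPoint B' hl', ← WithTop.coe_add,
    WithTop.coe_le_coe] at hb₁ hb₂
  have key : ∀ {b b' : ℝ} {d d' : WithTop ℝ}, b ≤ b' + η → d ≤ d' + η →
      max (b : WithTop ℝ) d ≤ max (b' : WithTop ℝ) d' + η := by
    intro b b' d d' h h'
    refine max_le ?_ (h'.trans (by gcongr; exact le_max_right _ _))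
    calc (b : WithTop ℝ) ≤ ((b' + η : ℝ) : WithTop ℝ) := WithTop.coe_le_coe.mpr h
      _ = b' + η := WithTop.coe_add _ _
      _ ≤ _ := by gcongr; exact le_max_left _ _
  rw [DiagramPoint.supDist_le_ofReal_iff hη]
  refine ⟨abs_le.mpr ⟨by linarith, by linarith⟩, key hb₂ (hB'.level_le_add hB h₄ hx),
    key hb₁ (hB.level_le_add hB' h₃ hx)⟩

/-- Both diagrams are indexed by the same basis, so each vector is matched with itself; its improper
points serve as the diagonal padding. The shifts ensure that the same vectors have finite birth. -/
theorem diagramClose_levelDiagram {𝕜 : Type v} [Field 𝕜] {V : Type w} [AddCommGroup V]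
    [Module 𝕜 V] {n : ℕ} (β : Module.Basis (Fin n) 𝕜 V) {Z B Z' B' : ℝ → Submodule 𝕜 V}
    (hZ : IsTame Z) (hB : IsTame B) (hZ' : IsTame Z') (hB' : IsTame B') {η : ℝ} (hη : 0 ≤ η)
    (h₁ : ∀ ε, Z ε ≤ Z' (ε + η)) (h₂ : ∀ ε, Z' ε ≤ Z (ε + η))
    (h₃ : ∀ ε, B ε ≤ B' (ε + η)) (h₄ : ∀ ε, B' ε ≤ B (ε + η))
    [DecidablePred DiagramPoint.IsProper] :
    DiagramClose η ((levelDiagram β Z B).filter DiagramPoint.IsProper)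
      ((levelDiagram β Z' B').filter DiagramPoint.IsProper) := by
  refine ⟨(levelDiagram β Z B).filter fun P => ¬ P.IsProper,
    (levelDiagram β Z' B').filter fun P => ¬ P.IsProper,
    fun P hP => (Multiset.mem_filter.mp hP).2, fun P hP => (Multiset.mem_filter.mp hP).2, ?_⟩
  rw [Multiset.filter_add_not, Multiset.filter_add_not]
  have hiff : ∀ i, level Z (β i) ≠ ⊤ ↔ level Z' (β i) ≠ ⊤ := fun i => by
    constructor <;> intro h
    · exact ne_top_of_le_ne_top (WithTop.add_ne_top.mpr ⟨h, WithTop.coe_ne_top⟩)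
        (hZ.level_le_add hZ' h₁ (β.ne_zero i))
    · exact ne_top_of_le_ne_top (WithTop.add_ne_top.mpr ⟨h, WithTop.coe_ne_top⟩)
        (hZ'.level_le_add hZ h₂ (β.ne_zero i))
  simp only [levelDiagram, ← hiff]
  rw [Multiset.rel_map]
  refine Multiset.rel_refl_of_refl_on fun i hi => ?_
  have hl : level Z (β i) ≠ ⊤ := by simpa using hi
  exact supDist_levelPoint_le hZ hB hZ' hB' hη h₁ h₂ h₃ h₄ (β.ne_zero i) hl ((hiff i).mp hl)

/-! ### Tameness of the sublevel filtration -/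

/-- A filtration function takes finitely many values, so none lies just to the right of `ε`. -/
theorem FilteredSpace.exists_sublevel_le (W : FilteredSpace.{u}) (ε : ℝ) :
    ∃ δ > ε, W.sublevel δ ≤ W.sublevel ε := by
  have h : ∀ᶠ δ in nhdsWithin ε (Set.Ioi ε), ∀ σ, W.filt σ ≤ δ → W.filt σ ≤ ε := by
    rw [Filter.eventually_all]
    intro σ
    rcases le_or_gt (W.filt σ) ε with h | h
    · exact Filter.Eventually.of_forall fun _ _ => h
    · filter_upwards [Ioo_mem_nhdsGT h] with δ hδ hle
      exact absurd hle hδ.2.not_ge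
  obtain ⟨δ, hδ, hlt⟩ := (h.and self_mem_nhdsWithin).exists
  exact ⟨δ, hlt, fun σ hσ => ⟨hσ.1, hδ σ hσ.2⟩⟩

theorem FilteredSpace.exists_chainsOf_sublevel_eq_bot (𝕜 : Type v) [Field 𝕜]
    (W : FilteredSpace.{u}) : ∃ ε, ∀ k, chainsOf 𝕜 (W.sublevel ε) k = ⊥ := by
  classical
  -- By monotonicity `W.filt ∅` is the least value, although `∅` is no simplex.
  refine ⟨W.filt ∅ - 1, fun k => ?_⟩
  have h : {x : Fin (k + 1) → W.carrier |
      Finset.univ.image x ∈ (W.sublevel (W.filt ∅ - 1)).faces} = ∅ := by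
    ext x
    simp only [Set.mem_ofPred_eq, Set.mem_empty_iff_false, iff_false]
    intro hx
    have h₁ : W.filt (Finset.univ.image x) ≤ W.filt ∅ - 1 := hx.2
    have h₂ : W.filt ∅ ≤ W.filt (Finset.univ.image x) := W.mono (Finset.empty_subset _)
    linarith
  rw [eq_bot_iff]
  intro c hc
  unfold chainsOf at hc
  rw [Finsupp.mem_supported] at hc
  have : (c.support : Set (Fin (k + 1) → W.carrier)) ⊆ ∅ := by
    rw [← h]
    convert hc
  simpa using Set.subset_eq_empty this rfl

theorem cyclesOf_le_chainsOf (𝕜 : Type v) [Field 𝕜] {V : Type u}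
    (L : PreAbstractSimplicialComplex V) (k : ℕ) : cyclesOf 𝕜 L k ≤ chainsOf 𝕜 L k := by
  cases k with
  | zero => exact le_rfl
  | succ k => exact inf_le_left

theorem FilteredSpace.isTame_cyclesOf (𝕜 : Type v) [Field 𝕜] (k : ℕ) (W : FilteredSpace.{u}) :
    IsTame fun ε => cyclesOf 𝕜 (W.sublevel ε) k where
  mono _ _ h := cyclesOf_mono 𝕜 (W.sublevel_mono h) k
  right ε := by
    obtain ⟨δ, hδ, h⟩ := W.exists_sublevel_le ε
    exact ⟨δ, hδ, cyclesOf_mono 𝕜 h k⟩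
  bot := by
    obtain ⟨ε, hε⟩ := W.exists_chainsOf_sublevel_eq_bot 𝕜
    exact ⟨ε, le_bot_iff.mp ((cyclesOf_le_chainsOf 𝕜 _ k).trans (hε k).le)⟩

theorem FilteredSpace.isTame_boundariesOf (𝕜 : Type v) [Field 𝕜] (k : ℕ)
    (W : FilteredSpace.{u}) : IsTame fun ε => boundariesOf 𝕜 (W.sublevel ε) k where
  mono _ _ h := boundariesOf_mono 𝕜 (W.sublevel_mono h) k
  right ε := by
    obtain ⟨δ, hδ, h⟩ := W.exists_sublevel_le ε
    exact ⟨δ, hδ, boundariesOf_mono 𝕜 h k⟩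
  bot := by
    obtain ⟨ε, hε⟩ := W.exists_chainsOf_sublevel_eq_bot 𝕜
    exact ⟨ε, by simp [boundariesOf, hε]⟩

/-! ### Stability without inversions -/

/-- Two functions have no inversions if no pair is ordered strictly oppositely by them. -/
def NoInversion {α : Type*} (F G : α → ℝ) : Prop :=
  ∀ σ τ, F σ < F τ → G σ ≤ G τ

/-- If `σ` and `τ` witness that neither complex contains the other, then `F σ ≤ ε < F τ` and `G τ ≤
δ < G σ`, an inversion. -/
theorem isChain_sublevel {V : Type u} [Finite V] {F G : Finset V → ℝ} (hF : Monotone F)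
    (hG : Monotone G) (h : NoInversion F G) :
    IsChain (· ≤ ·) (Set.range (FilteredSpace.mk V F hF).sublevel ∪
      Set.range (FilteredSpace.mk V G hG).sublevel) := by
  have hFG : ∀ ε δ, (FilteredSpace.mk V F hF).sublevel ε ≤ (FilteredSpace.mk V G hG).sublevel δ ∨
      (FilteredSpace.mk V G hG).sublevel δ ≤ (FilteredSpace.mk V F hF).sublevel ε := by
    intro ε δ
    by_contra! hcon
    obtain ⟨hcon₁, hcon₂⟩ := hcon
    obtain ⟨σ, hσ, hσ'⟩ := Set.not_subset.mp hcon₁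
    obtain ⟨τ, hτ, hτ'⟩ := Set.not_subset.mp hcon₂
    have h₁ : F σ ≤ ε := hσ.2
    have h₂ : G τ ≤ δ := hτ.2
    have h₃ : δ < G σ := not_le.mp fun h => hσ' ⟨hσ.1, h⟩
    have h₄ : ε < F τ := not_le.mp fun h => hτ' ⟨hτ.1, h⟩
    linarith [h σ τ (by linarith)]
  rintro _ (⟨ε, rfl⟩ | ⟨ε, rfl⟩) _ (⟨δ, rfl⟩ | ⟨δ, rfl⟩) -
  · exact (le_total ε δ).imp (FilteredSpace.sublevel_mono _) (FilteredSpace.sublevel_mono _)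
  · exact hFG ε δ
  · exact (hFG δ ε).symm
  · exact (le_total ε δ).imp (FilteredSpace.sublevel_mono _) (FilteredSpace.sublevel_mono _)

/-- One basis is adapted to the cycles and the boundaries of both filtrations. -/
theorem exists_basis_adapted_of_noInversion (𝕜 : Type v) [Field 𝕜] (k : ℕ) {V : Type u} [Finite V]
    {F G : Finset V → ℝ} (hF : Monotone F) (hG : Monotone G) (h : NoInversion F G) :
    ∃ (n : ℕ) (β : Module.Basis (Fin n) 𝕜 (OrderedChain 𝕜 V k)),
      (∀ ε, β.IsAdapted (cyclesOf 𝕜 ((FilteredSpace.mk V F hF).sublevel ε) k)) ∧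
      (∀ ε, β.IsAdapted (boundariesOf 𝕜 ((FilteredSpace.mk V F hF).sublevel ε) k)) ∧
      (∀ ε, β.IsAdapted (cyclesOf 𝕜 ((FilteredSpace.mk V G hG).sublevel ε) k)) ∧
      (∀ ε, β.IsAdapted (boundariesOf 𝕜 ((FilteredSpace.mk V G hG).sublevel ε) k)) := by
  have hL := isChain_sublevel hF hG h
  -- One chain holds the cycles of both filtrations, the other the boundaries of both.
  obtain ⟨n, β, hβ⟩ := exists_basis_adapted
    (hL.image_of_map_rel _ (· ≤ ·) (fun L => cyclesOf 𝕜 L k) fun _ _ h => cyclesOf_mono 𝕜 h k)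
    (hL.image_of_map_rel _ (· ≤ ·) (fun L => boundariesOf 𝕜 L k)
      fun _ _ h => boundariesOf_mono 𝕜 h k)
  exact ⟨n, β, fun ε => hβ _ (Or.inl ⟨_, Or.inl ⟨ε, rfl⟩, rfl⟩),
    fun ε => hβ _ (Or.inr ⟨_, Or.inl ⟨ε, rfl⟩, rfl⟩),
    fun ε => hβ _ (Or.inl ⟨_, Or.inr ⟨ε, rfl⟩, rfl⟩),
    fun ε => hβ _ (Or.inr ⟨_, Or.inr ⟨ε, rfl⟩, rfl⟩)⟩

open Classical in
theorem FilteredSpace.isBarcode_levelDiagram {𝕜 : Type v} [Field 𝕜] {k : ℕ}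
    (W : FilteredSpace.{u}) {n : ℕ} (β : Module.Basis (Fin n) 𝕜 (OrderedChain 𝕜 W.carrier k))
    (hZ : ∀ ε, β.IsAdapted (cyclesOf 𝕜 (W.sublevel ε) k))
    (hB : ∀ ε, β.IsAdapted (boundariesOf 𝕜 (W.sublevel ε) k)) :
    IsBarcode (W.persistentHomology 𝕜 k)
      ((levelDiagram β (fun ε => cyclesOf 𝕜 (W.sublevel ε) k)
        fun ε => boundariesOf 𝕜 (W.sublevel ε) k).filter DiagramPoint.IsProper) :=
  isBarcode_subquotientModule β (W.isTame_cyclesOf 𝕜 k) (W.isTame_boundariesOf 𝕜 k) hZ hB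

theorem FilteredSpace.existsUnique_isBarcode (𝕜 : Type v) [Field 𝕜] (k : ℕ)
    (W : FilteredSpace.{u}) :
    ∃! D : PersistenceDiagram, IsBarcode (W.persistentHomology 𝕜 k) D := by
  classical
  -- A filtration has no inversions with itself.
  obtain ⟨n, β, hZ, hB, -⟩ := exists_basis_adapted_of_noInversion 𝕜 k W.mono W.mono
    fun _ _ h => h.le
  have h := W.isBarcode_levelDiagram β hZ hB
  exact ⟨_, h, fun _ h' => h'.unique h⟩

theorem FilteredSpace.diagram_eq {𝕜 : Type v} [Field 𝕜] {k : ℕ} {W : FilteredSpace.{u}}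
    {D : PersistenceDiagram} (h : IsBarcode (W.persistentHomology 𝕜 k) D) :
    W.diagram 𝕜 k = D :=
  (Classical.epsilon_spec (p := fun D => IsBarcode (W.persistentHomology 𝕜 k) D) ⟨D, h⟩).unique h

theorem FilteredSpace.sublevel_le_sublevel {V : Type u} [Finite V] {F G : Finset V → ℝ}
    (hF : Monotone F) (hG : Monotone G) {η : ℝ} (h : ∀ σ, G σ ≤ F σ + η) (ε : ℝ) :
    (FilteredSpace.mk V F hF).sublevel ε ≤ (FilteredSpace.mk V G hG).sublevel (ε + η) := by
  intro σ hσ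
  have h₁ : F σ ≤ ε := hσ.2
  exact ⟨hσ.1, show G σ ≤ ε + η by linarith [h σ]⟩

theorem diagramClose_of_noInversion (𝕜 : Type v) [Field 𝕜] (k : ℕ) {V : Type u} [Finite V]
    {F G : Finset V → ℝ} (hF : Monotone F) (hG : Monotone G) (h : NoInversion F G) {η : ℝ}
    (hη : 0 ≤ η) (hFG : ∀ σ, |F σ - G σ| ≤ η) :
    DiagramClose η ((FilteredSpace.mk V F hF).diagram 𝕜 k)
      ((FilteredSpace.mk V G hG).diagram 𝕜 k) := by
  classical
  obtain ⟨n, β, h₁, h₂, h₃, h₄⟩ := exists_basis_adapted_of_noInversion 𝕜 k hF hG h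
  rw [FilteredSpace.diagram_eq (FilteredSpace.isBarcode_levelDiagram ⟨V, F, hF⟩ β h₁ h₂),
    FilteredSpace.diagram_eq (FilteredSpace.isBarcode_levelDiagram ⟨V, G, hG⟩ β h₃ h₄)]
  have hle := FilteredSpace.sublevel_le_sublevel hF hG (η := η)
    fun σ => by linarith [(abs_le.mp (hFG σ)).1]
  have hge := FilteredSpace.sublevel_le_sublevel hG hF (η := η)
    fun σ => by linarith [(abs_le.mp (hFG σ)).2]
  exact diagramClose_levelDiagram β (FilteredSpace.isTame_cyclesOf 𝕜 k _)
    (FilteredSpace.isTame_boundariesOf 𝕜 k _) (FilteredSpace.isTame_cyclesOf 𝕜 k _)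
    (FilteredSpace.isTame_boundariesOf 𝕜 k _) hη (fun ε => cyclesOf_mono 𝕜 (hle ε) k)
    (fun ε => cyclesOf_mono 𝕜 (hge ε) k) (fun ε => boundariesOf_mono 𝕜 (hle ε) k)
    (fun ε => boundariesOf_mono 𝕜 (hge ε) k)

/-! ### Stability by induction on inversions -/

/-- Unless `F` and `G` have no inversions, some point of the segment from `F` to `G` has no
inversions with `F` and fewer inversions with `G` than `F` has. -/
theorem exists_fewer_inversions {α : Type*} [Finite α] {F G : α → ℝ} (h : ¬ NoInversion F G) :
    ∃ t : ℝ, 0 ≤ t ∧ t ≤ 1 ∧ NoInversion F (fun σ => (1 - t) * F σ + t * G σ) ∧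
      {p : α × α | (1 - t) * F p.1 + t * G p.1 < (1 - t) * F p.2 + t * G p.2 ∧ G p.2 < G p.1} ⊂
        {p : α × α | F p.1 < F p.2 ∧ G p.2 < G p.1} := by
  let I := {p : α × α | F p.1 < F p.2 ∧ G p.2 < G p.1}
  -- `c p` is the parameter at which the interpolated values on the pair `p` agree; its minimum over
  -- `I` is the first crossing.
  let c : α × α → ℝ := fun p => (F p.2 - F p.1) / ((F p.2 - F p.1) + (G p.1 - G p.2))
  have hI : I.Nonempty := by
    simp only [NoInversion, not_forall, not_le] at h
    obtain ⟨σ, τ, h₁, h₂⟩ := h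
    exact ⟨(σ, τ), h₁, h₂⟩
  obtain ⟨p, hp, hmin⟩ := Set.exists_min_image I c I.toFinite hI
  have hpos : ∀ q ∈ I, 0 < (F q.2 - F q.1) + (G q.1 - G q.2) := fun q hq =>
    add_pos (sub_pos.mpr hq.1) (sub_pos.mpr hq.2)
  have ht0 : 0 ≤ c p := div_nonneg (sub_pos.mpr hp.1).le (hpos p hp).le
  have ht1 : c p ≤ 1 := (div_le_one (hpos p hp)).mpr (by linarith [hp.2])
  refine ⟨c p, ht0, ht1, fun σ τ hστ => ?_, ?_, ?_⟩
  · rcases le_or_gt (G σ) (G τ) with hG | hG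
    · exact add_le_add (mul_le_mul_of_nonneg_left hστ.le (by linarith))
        (mul_le_mul_of_nonneg_left hG ht0)
    -- By minimality of `c p` this pair has not crossed earlier, so its order persists weakly.
    · have hq : (σ, τ) ∈ I := ⟨hστ, hG⟩
      have := hmin _ hq
      rw [le_div_iff₀ (hpos _ hq)] at this
      dsimp only at this ⊢
      nlinarith
  · rintro q ⟨hq₁, hq₂⟩
    refine ⟨?_, hq₂⟩
    by_contra! hle
    have h₁ := mul_le_mul_of_nonneg_left hle (by linarith : 0 ≤ 1 - c p)
    have h₂ := mul_le_mul_of_nonneg_left hq₂.le ht0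
    linarith
  -- The minimizing pair is tied at `c p` and so drops out of the inversions.
  · intro hsub
    have := (hsub hp).1
    have hc : c p * ((F p.2 - F p.1) + (G p.1 - G p.2)) = F p.2 - F p.1 :=
      div_mul_cancel₀ _ (hpos p hp).ne'
    nlinarith

/-- The stability theorem for two filtrations on the same set. -/
theorem diagramClose_of_abs_sub_le (𝕜 : Type v) [Field 𝕜] (k : ℕ) {V : Type u} [Finite V]
    {F G : Finset V → ℝ} (hF : Monotone F) (hG : Monotone G) {η : ℝ} (hη : 0 ≤ η)
    (hFG : ∀ σ, |F σ - G σ| ≤ η) :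
    DiagramClose η ((FilteredSpace.mk V F hF).diagram 𝕜 k)
      ((FilteredSpace.mk V G hG).diagram 𝕜 k) := by
  induction hn : {p : Finset V × Finset V | F p.1 < F p.2 ∧ G p.2 < G p.1}.ncard using
    Nat.strong_induction_on generalizing F η with
  | _ n ih =>
  by_cases h : NoInversion F G
  · exact diagramClose_of_noInversion 𝕜 k hF hG h hη hFG
  obtain ⟨t, ht0, ht1, hno, hlt⟩ := exists_fewer_inversions h
  have ht1' : 0 ≤ 1 - t := by linarith
  have hH : Monotone fun σ => (1 - t) * F σ + t * G σ := fun _ _ h =>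
    add_le_add (mul_le_mul_of_nonneg_left (hF h) ht1') (mul_le_mul_of_nonneg_left (hG h) ht0)
  -- The intermediate function divides the segment in the ratio `t : 1 - t`, so the two bounds add
  -- up to exactly `η`.
  have h₁ : DiagramClose (t * η) _ _ := diagramClose_of_noInversion 𝕜 k hF hH hno
    (mul_nonneg ht0 hη) fun σ => by
      rw [show F σ - ((1 - t) * F σ + t * G σ) = t * (F σ - G σ) by ring, abs_mul,
        abs_of_nonneg ht0]
      exact mul_le_mul_of_nonneg_left (hFG σ) ht0
  have h₂ : DiagramClose ((1 - t) * η) _ _ := ih _ (hn ▸ Set.ncard_lt_ncard hlt (Set.toFinite _))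
    hH (mul_nonneg ht1' hη) (fun σ => by
      rw [show (1 - t) * F σ + t * G σ - G σ = (1 - t) * (F σ - G σ) by ring, abs_mul,
        abs_of_nonneg ht1']
      exact mul_le_mul_of_nonneg_left (hFG σ) ht1') rfl
  have := h₁.trans (mul_nonneg ht0 hη) (mul_nonneg ht1' hη) h₂
  rwa [show t * η + (1 - t) * η = η by ring] at this

/-! ### Cones and the prism homotopy -/

/-- The map of chains induced by a map of vertices. -/
noncomputable def chainMap (𝕜 : Type v) [Field 𝕜] {V W : Type u} (f : V → W) (k : ℕ) :
    OrderedChain 𝕜 V k →ₗ[𝕜] OrderedChain 𝕜 W k :=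
  Finsupp.lmapDomain 𝕜 𝕜 fun x => f ∘ x

/-- The cone `(x₀,…,xₖ) ↦ (v,x₀,…,xₖ)`. -/
noncomputable def chainCone (𝕜 : Type v) [Field 𝕜] {V : Type u} (v : V) (k : ℕ) :
    OrderedChain 𝕜 V k →ₗ[𝕜] OrderedChain 𝕜 V (k + 1) :=
  Finsupp.lmapDomain 𝕜 𝕜 fun x => (Fin.cons v x : Fin (k + 1 + 1) → V)

theorem chainMap_single (𝕜 : Type v) [Field 𝕜] {V W : Type u} (f : V → W) {k : ℕ}
    (x : Fin (k + 1) → V) (a : 𝕜) :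
    chainMap 𝕜 f k (Finsupp.single x a) = Finsupp.single (f ∘ x) a :=
  Finsupp.mapDomain_single

theorem chainCone_single (𝕜 : Type v) [Field 𝕜] {V : Type u} (v : V) {k : ℕ}
    (x : Fin (k + 1) → V) (a : 𝕜) :
    chainCone 𝕜 v k (Finsupp.single x a) =
      Finsupp.single (Fin.cons v x : Fin (k + 1 + 1) → V) a :=
  Finsupp.mapDomain_single

theorem orderedBoundary_single (𝕜 : Type v) [Field 𝕜] {V : Type u} {k : ℕ}
    (x : Fin (k + 1 + 1) → V) (a : 𝕜) :
    orderedBoundary 𝕜 V k (Finsupp.single x a) =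
      ∑ i : Fin (k + 1 + 1), ((-1 : 𝕜) ^ (i : ℕ)) • Finsupp.single (fun j => x (i.succAbove j)) a := by
  simp [orderedBoundary]

theorem orderedBoundary_chainMap (𝕜 : Type v) [Field 𝕜] {V W : Type u} (f : V → W) {k : ℕ}
    (c : OrderedChain 𝕜 V (k + 1)) :
    orderedBoundary 𝕜 W k (chainMap 𝕜 f (k + 1) c) = chainMap 𝕜 f k (orderedBoundary 𝕜 V k c) := by
  induction c using Finsupp.induction_linear with
  | zero => simp
  | add c d hc hd => simp only [map_add, hc, hd]
  | single x a =>
    simp only [chainMap_single, orderedBoundary_single, map_sum, map_smul]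
    rfl

theorem chainMap_comp (𝕜 : Type v) [Field 𝕜] {U V W : Type u} (f : U → V) (g : V → W) {k : ℕ}
    (c : OrderedChain 𝕜 U k) : chainMap 𝕜 g k (chainMap 𝕜 f k c) = chainMap 𝕜 (g ∘ f) k c := by
  induction c using Finsupp.induction_linear with
  | zero => simp
  | add c d hc hd => simp only [map_add, hc, hd]
  | single x a => simp only [chainMap_single]; rfl

theorem chainMap_id (𝕜 : Type v) [Field 𝕜] {V : Type u} {k : ℕ} (c : OrderedChain 𝕜 V k) :
    chainMap 𝕜 id k c = c :=
  Finsupp.mapDomain_id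

theorem chainMap_chainCone (𝕜 : Type v) [Field 𝕜] {V W : Type u} (f : V → W) (v : V) {k : ℕ}
    (c : OrderedChain 𝕜 V k) :
    chainMap 𝕜 f (k + 1) (chainCone 𝕜 v k c) = chainCone 𝕜 (f v) k (chainMap 𝕜 f k c) := by
  induction c using Finsupp.induction_linear with
  | zero => simp
  | add c d hc hd => simp only [map_add, hc, hd]
  | single x a =>
    simp only [chainMap_single, chainCone_single]
    rw [Fin.comp_cons]

theorem orderedBoundary_chainCone_zero (𝕜 : Type v) [Field 𝕜] {V : Type u} (v : V)
    (x : Fin (0 + 1) → V) (a : 𝕜) :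
    orderedBoundary 𝕜 V 0 (chainCone 𝕜 v 0 (Finsupp.single x a)) =
      Finsupp.single x a - Finsupp.single (fun _ => v) a := by
  rw [chainCone_single, orderedBoundary_single, Fin.sum_univ_two]
  have h₁ : (fun j => (Fin.cons v x : Fin (0 + 1 + 1) → V) (Fin.succAbove 0 j)) = x := by
    ext j; simp
  have h₂ : (fun j => (Fin.cons v x : Fin (0 + 1 + 1) → V) (Fin.succAbove 1 j)) = fun _ => v := by
    ext j
    fin_cases j
    rfl
  rw [h₁, h₂]
  simp [sub_eq_add_neg]

/-- Deleting the apex returns `c`; deleting any other vertex gives the cone on a face of `c`, with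
the sign shifted by one. -/
theorem orderedBoundary_chainCone_succ (𝕜 : Type v) [Field 𝕜] {V : Type u} (v : V) {k : ℕ}
    (c : OrderedChain 𝕜 V (k + 1)) :
    orderedBoundary 𝕜 V (k + 1) (chainCone 𝕜 v (k + 1) c) =
      c - chainCone 𝕜 v k (orderedBoundary 𝕜 V k c) := by
  induction c using Finsupp.induction_linear with
  | zero => simp
  | add c d hc hd => simp only [map_add, hc, hd]; abel
  | single x a =>
    rw [chainCone_single, orderedBoundary_single, orderedBoundary_single, Fin.sum_univ_succ,
      map_sum, sub_eq_add_neg, ← Finset.sum_neg_distrib]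
    congr 1
    · simp
    · refine Finset.sum_congr rfl fun i _ => ?_
      have h : (fun j => (Fin.cons v x : Fin (k + 1 + 1 + 1) → V) (i.succ.succAbove j)) =
          Fin.cons v fun j => x (i.succAbove j) := by
        ext j
        refine Fin.cases ?_ (fun j => ?_) j <;> simp
      rw [h, map_smul, chainCone_single, Fin.val_succ, pow_succ]
      simp

/-- The prism on a tuple, `∑ᵢ (-1)ⁱ (x₀,…,xᵢ,g xᵢ,…,g xₖ)`. -/
noncomputable def prismTuple (𝕜 : Type v) [Field 𝕜] {V : Type u} (g : V → V) :
    (k : ℕ) → (Fin (k + 1) → V) → OrderedChain 𝕜 V (k + 1)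
  | 0, x => chainCone 𝕜 (x 0) 0 (Finsupp.single (g ∘ x) 1)
  | k + 1, x =>
    chainCone 𝕜 (x 0) (k + 1) (Finsupp.single (g ∘ x) 1 - prismTuple 𝕜 g k (Fin.tail x))

/-- The chain homotopy between the identity and the map induced by `g`. -/
noncomputable def prism (𝕜 : Type v) [Field 𝕜] {V : Type u} (g : V → V) (k : ℕ) :
    OrderedChain 𝕜 V k →ₗ[𝕜] OrderedChain 𝕜 V (k + 1) :=
  Finsupp.linearCombination 𝕜 (prismTuple 𝕜 g k)

/-- This is the recursion of `prismTuple` in linear form. Since every tuple of positive degree is a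
cone, it reduces the homotopy identity to boundaries of cones. -/
theorem prism_chainCone (𝕜 : Type v) [Field 𝕜] {V : Type u} (g : V → V) (v : V) {k : ℕ}
    (c : OrderedChain 𝕜 V k) :
    prism 𝕜 g (k + 1) (chainCone 𝕜 v k c) =
      chainCone 𝕜 v (k + 1) (chainCone 𝕜 (g v) k (chainMap 𝕜 g k c) - prism 𝕜 g k c) := by
  induction c using Finsupp.induction_linear with
  | zero => simp
  | add c d hc hd => simp only [map_add, map_sub, hc, hd]; abel
  | single x a =>
    rw [chainCone_single, chainMap_single, chainCone_single, prism, prism,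
      Finsupp.linearCombination_single, Finsupp.linearCombination_single, prismTuple,
      ← map_smul, smul_sub, Finsupp.smul_single, smul_eq_mul, mul_one, Fin.comp_cons,
      Fin.cons_zero, Fin.tail_cons]

theorem orderedBoundary_prism_zero (𝕜 : Type v) [Field 𝕜] {V : Type u} (g : V → V)
    (c : OrderedChain 𝕜 V 0) :
    orderedBoundary 𝕜 V 0 (prism 𝕜 g 0 c) = chainMap 𝕜 g 0 c - c := by
  induction c using Finsupp.induction_linear with
  | zero => simp
  | add c d hc hd => simp only [map_add, hc, hd]; abel
  | single x a =>
    have h : (fun _ => x 0) = x := by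
      ext j
      fin_cases j
      rfl
    rw [chainMap_single, prism, Finsupp.linearCombination_single, prismTuple, ← map_smul,
      Finsupp.smul_single, smul_eq_mul, mul_one, orderedBoundary_chainCone_zero, h]

theorem chain_induction_cone (𝕜 : Type v) [Field 𝕜] {V : Type u} {k : ℕ}
    {p : OrderedChain 𝕜 V (k + 1) → Prop} (h0 : p 0) (hadd : ∀ c d, p c → p d → p (c + d))
    (hcone : ∀ v x a, p (chainCone 𝕜 v k (Finsupp.single x a))) (c : OrderedChain 𝕜 V (k + 1)) :
    p c := by
  induction c using Finsupp.induction_linear with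
  | zero => exact h0
  | add c d hc hd => exact hadd c d hc hd
  | single x a =>
    have := hcone (x 0) (Fin.tail x) a
    rwa [chainCone_single, Fin.cons_self_tail] at this

/-- On a cone, both sides unfold by the cone formulas and the identity one degree lower. The base
case is separate because the boundary of a cone on a vertex contains the apex. -/
theorem orderedBoundary_prism_succ (𝕜 : Type v) [Field 𝕜] {V : Type u} (g : V → V) (k : ℕ)
    (c : OrderedChain 𝕜 V (k + 1)) :
    orderedBoundary 𝕜 V (k + 1) (prism 𝕜 g (k + 1) c) =
      chainMap 𝕜 g (k + 1) c - c - prism 𝕜 g k (orderedBoundary 𝕜 V k c) := by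
  induction k with
  | zero =>
    induction c using chain_induction_cone with
    | h0 => simp
    | hadd c d hc hd => simp only [map_add, hc, hd]; abel
    | hcone v x a =>
      have h : prism 𝕜 g 0 (Finsupp.single (fun _ => v) a) =
          chainCone 𝕜 v 0 (Finsupp.single (fun _ => g v) a) := by
        rw [prism, Finsupp.linearCombination_single, prismTuple, ← map_smul, Finsupp.smul_single,
          smul_eq_mul, mul_one]
        rfl
      rw [prism_chainCone, orderedBoundary_chainCone_succ, map_sub, orderedBoundary_prism_zero,
        orderedBoundary_chainCone_zero, chainMap_chainCone, chainMap_single,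
        orderedBoundary_chainCone_zero, map_sub (prism 𝕜 g 0), h]
      simp only [map_sub]
      abel
  | succ k ih =>
    induction c using chain_induction_cone with
    | h0 => simp
    | hadd c d hc hd => simp only [map_add, hc, hd]; abel
    | hcone v x a =>
      rw [prism_chainCone, orderedBoundary_chainCone_succ, map_sub, ih,
        orderedBoundary_chainCone_succ, chainMap_chainCone, orderedBoundary_chainCone_succ,
        map_sub (prism 𝕜 g (k + 1)), prism_chainCone, orderedBoundary_chainMap]
      simp only [map_sub]
      abel

/-- The prism uses only the vertices `x j` and `g (x j)`, which `f` does not distinguish. A free `S`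
lets the induction pass to the tail of `x`. -/
theorem prismTuple_mem_supported (𝕜 : Type v) [Field 𝕜] {V W : Type u} {g : V → V} {f : V → W}
    (hfg : ∀ v, f (g v) = f v) {S : Set W} {k : ℕ} {x : Fin (k + 1) → V} (hx : ∀ j, f (x j) ∈ S) :
    prismTuple 𝕜 g k x ∈ Finsupp.supported 𝕜 𝕜 {y | ∀ j, f (y j) ∈ S} := by
  have hcone : ∀ {k : ℕ} {v : V} {c : OrderedChain 𝕜 V k}, f v ∈ S →
      c ∈ Finsupp.supported 𝕜 𝕜 {y | ∀ j, f (y j) ∈ S} →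
      chainCone 𝕜 v k c ∈ Finsupp.supported 𝕜 𝕜 {y | ∀ j, f (y j) ∈ S} := by
    intro k v c hv hc
    refine Finsupp.supported_comap_lmapDomain 𝕜 𝕜 _ _ (Finsupp.supported_mono ?_ hc)
    intro y hy j
    refine Fin.cases ?_ (fun j => ?_) j
    · simpa using hv
    · simpa using hy j
  have hsingle : ∀ {k : ℕ} {x : Fin (k + 1) → V}, (∀ j, f (x j) ∈ S) →
      (Finsupp.single (g ∘ x) 1 : OrderedChain 𝕜 V k) ∈
        Finsupp.supported 𝕜 𝕜 {y | ∀ j, f (y j) ∈ S} := fun hx =>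
    Finsupp.single_mem_supported 𝕜 _ fun j => (hfg _).symm ▸ hx j
  induction k with
  | zero => exact hcone (hx 0) (hsingle hx)
  | succ k ih =>
    exact hcone (hx 0) (Submodule.sub_mem _ (hsingle hx) (ih fun j => hx j.succ))

/-! ### Invariance under surjective pullbacks -/

/-- A filtered space pulled back along a map. -/
noncomputable def FilteredSpace.pullbackSpace (X : FilteredSpace.{u}) {Z : Type u} [Finite Z]
    (f : Z → X.carrier) : FilteredSpace.{u} where
  carrier := Z
  filt := X.pullback f
  mono := X.pullback_mono f

/-- The sublevel complexes of a pullback. -/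
noncomputable def FilteredSpace.pullbackSublevel (X : FilteredSpace.{u}) {Z : Type u} [Finite Z]
    (f : Z → X.carrier) (ε : ℝ) : PreAbstractSimplicialComplex Z :=
  (X.pullbackSpace f).sublevel ε

open Classical in
theorem FilteredSpace.image_mem_pullbackSublevel (X : FilteredSpace.{u}) {Z : Type u}
    [Finite Z] (f : Z → X.carrier) {k : ℕ} (x : Fin (k + 1) → Z) (ε : ℝ) :
    Finset.univ.image x ∈ (X.pullbackSublevel f ε).faces ↔
      Finset.univ.image (f ∘ x) ∈ (X.sublevel ε).faces := by
  change _ ∧ X.filt ((Finset.univ.image x).image f) ≤ ε ↔ _ ∧ X.filt _ ≤ ε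
  rw [Finset.image_image]
  exact and_congr_left fun _ =>
    iff_of_true (Finset.univ_nonempty.image _) (Finset.univ_nonempty.image _)

theorem FilteredSpace.chainMap_mem_chainsOf (𝕜 : Type v) [Field 𝕜] (X : FilteredSpace.{u})
    {Z : Type u} [Finite Z] (f : Z → X.carrier) {k : ℕ} {ε : ℝ} {c : OrderedChain 𝕜 Z k}
    (hc : c ∈ chainsOf 𝕜 (X.pullbackSublevel f ε) k) :
    chainMap 𝕜 f k c ∈ chainsOf 𝕜 (X.sublevel ε) k :=
  Finsupp.supported_comap_lmapDomain 𝕜 𝕜 _ _ (Finsupp.supported_mono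
    (fun x hx => (X.image_mem_pullbackSublevel f x ε).mp hx) hc)

theorem FilteredSpace.chainMap_section_mem_chainsOf (𝕜 : Type v) [Field 𝕜]
    (X : FilteredSpace.{u}) {Z : Type u} [Finite Z] {f : Z → X.carrier} {s : X.carrier → Z}
    (hs : ∀ x, f (s x) = x) {k : ℕ} {ε : ℝ} {c : OrderedChain 𝕜 X.carrier k}
    (hc : c ∈ chainsOf 𝕜 (X.sublevel ε) k) :
    chainMap 𝕜 s k c ∈ chainsOf 𝕜 (X.pullbackSublevel f ε) k := by
  refine Finsupp.supported_comap_lmapDomain 𝕜 𝕜 _ _ (Finsupp.supported_mono (fun x hx => ?_) hc)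
  refine (X.image_mem_pullbackSublevel f (s ∘ x) ε).mpr ?_
  have h : f ∘ s ∘ x = x := by
    ext j
    simp [hs]
  rw [h]
  exact hx

/-- The pullback filtration sees only images under `f`, and those of the prism lie in the image of
the original simplex. -/
theorem FilteredSpace.prism_mem_chainsOf (𝕜 : Type v) [Field 𝕜] (X : FilteredSpace.{u})
    {Z : Type u} [Finite Z] {f : Z → X.carrier} {g : Z → Z} (hfg : ∀ v, f (g v) = f v) {k : ℕ}
    {ε : ℝ} {c : OrderedChain 𝕜 Z k}
    (hc : c ∈ chainsOf 𝕜 (X.pullbackSublevel f ε) k) :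
    prism 𝕜 g k c ∈ chainsOf 𝕜 (X.pullbackSublevel f ε) (k + 1) := by
  rw [prism, Finsupp.linearCombination_apply]
  refine Submodule.sum_mem _ fun x hx => Submodule.smul_mem _ _ ?_
  have hx' := (X.image_mem_pullbackSublevel f x ε).mp (hc hx)
  refine Finsupp.supported_mono (fun y hy => ?_)
    (prismTuple_mem_supported 𝕜 hfg (S := Set.range (f ∘ x)) fun j => ⟨j, rfl⟩)
  refine (X.image_mem_pullbackSublevel f y ε).mpr ⟨by simp, le_trans (X.mono ?_) hx'.2⟩
  intro z hz
  classical
  obtain ⟨j, -, rfl⟩ := Finset.mem_image.mp hz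
  obtain ⟨i, hi⟩ := hy j
  exact Finset.mem_image.mpr ⟨i, Finset.mem_univ _, hi⟩

/-- A chain map that preserves chains preserves cycles. -/
theorem chainMap_mem_cyclesOf {𝕜 : Type v} [Field 𝕜] {V W : Type u}
    {L : PreAbstractSimplicialComplex V} {M : PreAbstractSimplicialComplex W} {f : V → W}
    {k : ℕ} (h : ∀ c ∈ chainsOf 𝕜 L k, chainMap 𝕜 f k c ∈ chainsOf 𝕜 M k)
    {c : OrderedChain 𝕜 V k} (hc : c ∈ cyclesOf 𝕜 L k) : chainMap 𝕜 f k c ∈ cyclesOf 𝕜 M k := by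
  cases k with
  | zero => exact h c hc
  | succ k =>
    refine ⟨h c hc.1, ?_⟩
    change orderedBoundary 𝕜 W k _ = 0
    rw [orderedBoundary_chainMap, LinearMap.mem_ker.mp hc.2, map_zero]

theorem chainMap_mem_boundariesOf {𝕜 : Type v} [Field 𝕜] {V W : Type u}
    {L : PreAbstractSimplicialComplex V} {M : PreAbstractSimplicialComplex W} {f : V → W}
    {k : ℕ} (h : ∀ c ∈ chainsOf 𝕜 L (k + 1), chainMap 𝕜 f (k + 1) c ∈ chainsOf 𝕜 M (k + 1))
    {c : OrderedChain 𝕜 V k} (hc : c ∈ boundariesOf 𝕜 L k) :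
    chainMap 𝕜 f k c ∈ boundariesOf 𝕜 M k := by
  obtain ⟨b, hb, rfl⟩ := hc
  exact ⟨_, h b hb, orderedBoundary_chainMap 𝕜 f b⟩

/-- The map on the homology of a pullback that is induced by `s ∘ f`, where `s` is a section of
`f`, is the identity. -/
theorem FilteredSpace.chainMap_sub_mem_boundariesOf (𝕜 : Type v) [Field 𝕜] (X : FilteredSpace.{u})
    {Z : Type u} [Finite Z] {f : Z → X.carrier} {g : Z → Z} (hfg : ∀ v, f (g v) = f v) {k : ℕ}
    {ε : ℝ} {c : OrderedChain 𝕜 Z k}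
    (hc : c ∈ cyclesOf 𝕜 (X.pullbackSublevel f ε) k) :
    chainMap 𝕜 g k c - c ∈ boundariesOf 𝕜 (X.pullbackSublevel f ε) k := by
  refine ⟨prism 𝕜 g k c, X.prism_mem_chainsOf 𝕜 hfg (cyclesOf_le_chainsOf 𝕜 _ k hc), ?_⟩
  cases k with
  | zero => exact orderedBoundary_prism_zero 𝕜 g c
  | succ k =>
    have h : orderedBoundary 𝕜 Z k c = 0 := hc.2
    rw [orderedBoundary_prism_succ, h, map_zero, sub_zero]

/-- The map of subquotients induced by a linear map. -/
def subquotientMap {𝕜 : Type v} [Field 𝕜] {C C' : Type u} [AddCommGroup C] [Module 𝕜 C]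
    [AddCommGroup C'] [Module 𝕜 C'] {Z B : Submodule 𝕜 C} {Z' B' : Submodule 𝕜 C'}
    (f : C →ₗ[𝕜] C') (hZ : ∀ z ∈ Z, f z ∈ Z') (hB : ∀ z ∈ B, f z ∈ B') :
    Subquotient Z B →ₗ[𝕜] Subquotient Z' B' :=
  Submodule.mapQ (B.submoduleOf Z) (B'.submoduleOf Z') (f.restrict hZ) fun z hz => hB z hz

theorem subquotientMap_bijective {𝕜 : Type v} [Field 𝕜] {C C' : Type u} [AddCommGroup C]
    [Module 𝕜 C] [AddCommGroup C'] [Module 𝕜 C'] {Z B : Submodule 𝕜 C} {Z' B' : Submodule 𝕜 C'}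
    {f : C →ₗ[𝕜] C'} (hZ : ∀ z ∈ Z, f z ∈ Z') (hB : ∀ z ∈ B, f z ∈ B')
    (hinj : ∀ z ∈ Z, f z ∈ B' → z ∈ B) (hsurj : ∀ z ∈ Z', ∃ y ∈ Z, f y = z) :
    Function.Bijective (subquotientMap f hZ hB) := by
  constructor
  · rw [injective_iff_map_eq_zero]
    intro x
    refine Submodule.Quotient.induction_on _ x fun z hz => ?_
    refine (Submodule.Quotient.mk_eq_zero _).mpr (hinj z z.2 ?_)
    exact (Submodule.Quotient.mk_eq_zero (B'.submoduleOf Z')).mp hz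
  · intro x
    refine Submodule.Quotient.induction_on _ x fun z => ?_
    obtain ⟨y, hy, hyz⟩ := hsurj z z.2
    refine ⟨Submodule.Quotient.mk ⟨y, hy⟩, ?_⟩
    exact congrArg Submodule.Quotient.mk (Subtype.ext hyz)

/-- For a section `s`, `f ∘ s = id` lifts every cycle. If `f` sends a cycle to a boundary, so does
`s ∘ f`, which is homotopic to the identity; hence the cycle bounds. -/
theorem FilteredSpace.nonempty_iso_pullbackSpace (𝕜 : Type v) [Field 𝕜] (k : ℕ)
    (X : FilteredSpace.{u}) {Z : Type u} [Finite Z] {f : Z → X.carrier}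
    (hf : Function.Surjective f) :
    Nonempty (((X.pullbackSpace f).persistentHomology 𝕜 k).Iso (X.persistentHomology 𝕜 k)) := by
  obtain ⟨s, hs⟩ := hf.hasRightInverse
  have hZ : ∀ ε, ∀ z ∈ cyclesOf 𝕜 (X.pullbackSublevel f ε) k,
      chainMap 𝕜 f k z ∈ cyclesOf 𝕜 (X.sublevel ε) k := fun ε _ =>
    chainMap_mem_cyclesOf (L := X.pullbackSublevel f ε) fun _ => X.chainMap_mem_chainsOf 𝕜 f
  have hB : ∀ ε, ∀ z ∈ boundariesOf 𝕜 (X.pullbackSublevel f ε) k,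
      chainMap 𝕜 f k z ∈ boundariesOf 𝕜 (X.sublevel ε) k := fun ε _ =>
    chainMap_mem_boundariesOf fun _ => X.chainMap_mem_chainsOf 𝕜 f
  have hbij : ∀ ε, Function.Bijective (subquotientMap (chainMap 𝕜 f k) (hZ ε) (hB ε)) := by
    intro ε
    refine subquotientMap_bijective _ _ (fun z hz hzB => ?_) fun z hz => ?_
    · have h₁ := chainMap_mem_boundariesOf
        (fun _ => X.chainMap_section_mem_chainsOf 𝕜 hs) hzB
      rw [chainMap_comp] at h₁
      have h₂ := X.chainMap_sub_mem_boundariesOf 𝕜 (g := s ∘ f) (fun v => hs (f v)) hz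
      simpa using Submodule.sub_mem _ h₁ h₂
    · refine ⟨chainMap 𝕜 s k z,
        chainMap_mem_cyclesOf (fun _ => X.chainMap_section_mem_chainsOf 𝕜 hs) hz, ?_⟩
      rw [chainMap_comp, hs.comp_eq_id, chainMap_id]
  exact ⟨⟨fun ε => LinearEquiv.ofBijective _ (hbij ε), fun h x =>
    Submodule.Quotient.induction_on _ x fun _ => rfl⟩⟩

theorem FilteredSpace.diagram_pullbackSpace (𝕜 : Type v) [Field 𝕜] (k : ℕ)
    (X : FilteredSpace.{u}) {Z : Type u} [Finite Z] {f : Z → X.carrier}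
    (hf : Function.Surjective f) :
    (X.pullbackSpace f).diagram 𝕜 k = X.diagram 𝕜 k := by
  obtain ⟨e⟩ := X.nonempty_iso_pullbackSpace 𝕜 k hf
  obtain ⟨D, hD, -⟩ := X.existsUnique_isBarcode 𝕜 k
  rw [diagram_eq hD, diagram_eq (hD.of_iso e)]

/-! ### Length of the curve of a tripod -/

theorem Tripod.cost_ne_top {X Y : FilteredSpace.{u}} (T : Tripod X Y) : T.cost ≠ ⊤ := by
  obtain ⟨τ, hτ⟩ := Finite.exists_max
    fun τ : Finset T.Z => ENNReal.ofReal |X.pullback T.toX τ - Y.pullback T.toY τ|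
  exact ne_top_of_le_ne_top ENNReal.ofReal_ne_top (iSup_le hτ)

theorem Tripod.abs_sub_le_cost {X Y : FilteredSpace.{u}} (T : Tripod X Y) (τ : Finset T.Z) :
    |X.pullback T.toX τ - Y.pullback T.toY τ| ≤ T.cost.toReal := by
  rw [← ENNReal.ofReal_le_iff_le_toReal T.cost_ne_top]
  exact le_iSup (fun τ => ENNReal.ofReal |X.pullback T.toX τ - Y.pullback T.toY τ|) τ

/-- The curve of a tripod is Lipschitz. -/
theorem Tripod.bottleneckDist_curve_le (𝕜 : Type v) [Field 𝕜] (k : ℕ) {X Y : FilteredSpace.{u}}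
    (T : Tripod X Y) {s t : unitInterval} (h : s ≤ t) :
    bottleneckDist ((T.curve s).diagram 𝕜 k) ((T.curve t).diagram 𝕜 k) ≤
      ENNReal.ofReal (((t : ℝ) - s) * T.cost.toReal) := by
  have hst : 0 ≤ (t : ℝ) - s := sub_nonneg.mpr h
  have hη : 0 ≤ ((t : ℝ) - s) * T.cost.toReal := mul_nonneg hst ENNReal.toReal_nonneg
  refine DiagramClose.bottleneckDist_le hη ?_
  refine diagramClose_of_abs_sub_le 𝕜 k (T.curve s).mono (T.curve t).mono hη fun τ => ?_
  change |((1 - (s : ℝ)) * X.pullback T.toX τ + (s : ℝ) * Y.pullback T.toY τ) -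
    ((1 - (t : ℝ)) * X.pullback T.toX τ + (t : ℝ) * Y.pullback T.toY τ)| ≤ _
  rw [show ∀ a b : ℝ, ((1 - (s : ℝ)) * a + (s : ℝ) * b) - ((1 - (t : ℝ)) * a + (t : ℝ) * b) =
    ((t : ℝ) - s) * (a - b) by intros; ring, abs_mul, abs_of_nonneg hst]
  exact mul_le_mul_of_nonneg_left (T.abs_sub_le_cost τ) hst

theorem Tripod.diagramLength_le_cost (𝕜 : Type v) [Field 𝕜] (k : ℕ) {X Y : FilteredSpace.{u}}
    (T : Tripod X Y) : (diagramLength fun t => (T.curve t).diagram 𝕜 k) ≤ T.cost := by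
  refine iSup_le fun n => iSup_le fun t => iSup_le fun ⟨hmono, h0, h1⟩ => ?_
  have hle : ∀ i : Fin n, t i.castSucc ≤ t i.succ := fun i =>
    (hmono i.castSucc_lt_succ).le
  calc ∑ i : Fin n, bottleneckDist ((T.curve (t i.castSucc)).diagram 𝕜 k)
        ((T.curve (t i.succ)).diagram 𝕜 k)
      ≤ ∑ i : Fin n, ENNReal.ofReal (((t i.succ : ℝ) - t i.castSucc) * T.cost.toReal) :=
        Finset.sum_le_sum fun i _ => T.bottleneckDist_curve_le 𝕜 k (hle i)
    _ = ENNReal.ofReal (∑ i : Fin n, ((t i.succ : ℝ) - t i.castSucc) * T.cost.toReal) :=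
        (ENNReal.ofReal_sum_of_nonneg fun i _ =>
          mul_nonneg (sub_nonneg.mpr (hle i)) ENNReal.toReal_nonneg).symm
    _ = ENNReal.ofReal T.cost.toReal := by
        have hsum : ∑ i : Fin n, ((t i.succ : ℝ) - t i.castSucc) = 1 := by
          -- Splitting off the first and the last term of the same sum makes the differences
          -- telescope to `1 - 0`.
          have h₁ := Fin.sum_univ_succ fun i => (t i : ℝ)
          have h₂ := Fin.sum_univ_castSucc fun i => (t i : ℝ)
          rw [h0] at h₁
          rw [h1] at h₂
          rw [Finset.sum_sub_distrib]
          simp only [Set.Icc.coe_zero, Set.Icc.coe_one] at h₁ h₂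
          linarith
        rw [← Finset.sum_mul, hsum, one_mul]
    _ = T.cost := ENNReal.ofReal_toReal T.cost_ne_top

theorem Tripod.diagram_curve_zero (𝕜 : Type v) [Field 𝕜] (k : ℕ) {X Y : FilteredSpace.{u}}
    (T : Tripod X Y) : (T.curve 0).diagram 𝕜 k = X.diagram 𝕜 k := by
  have h : T.curve 0 = X.pullbackSpace T.toX := by simp [curve, FilteredSpace.pullbackSpace]
  rw [h, X.diagram_pullbackSpace 𝕜 k T.surjective_toX]

theorem Tripod.diagram_curve_one (𝕜 : Type v) [Field 𝕜] (k : ℕ) {X Y : FilteredSpace.{u}}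
    (T : Tripod X Y) : (T.curve 1).diagram 𝕜 k = Y.diagram 𝕜 k := by
  have h : T.curve 1 = Y.pullbackSpace T.toY := by simp [curve, FilteredSpace.pullbackSpace]
  rw [h, Y.diagram_pullbackSpace 𝕜 k T.surjective_toY]

theorem bottleneckDist_le_diagramLength (α : unitInterval → PersistenceDiagram) :
    bottleneckDist (α 0) (α 1) ≤ diagramLength α := by
  have h : StrictMono (![0, 1] : Fin 2 → unitInterval) := by
    rw [Fin.strictMono_iff_lt_succ]
    intro i
    fin_cases i
    exact zero_lt_one
  refine le_trans ?_ (le_iSup₂_of_le 1 ![0, 1] (le_iSup_of_le ⟨h, rfl, rfl⟩ le_rfl))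
  simp

/-! ### Existence of optimal tripods -/

/-- The tripod given by a correspondence. -/
def Tripod.ofSet {X Y : FilteredSpace.{u}} (R : Set (X.carrier × Y.carrier))
    (h₁ : ∀ x, ∃ p ∈ R, p.1 = x) (h₂ : ∀ y, ∃ p ∈ R, p.2 = y) : Tripod X Y where
  Z := R
  toX p := p.1.1
  toY p := p.1.2
  surjective_toX x := by
    obtain ⟨p, hp, hx⟩ := h₁ x
    exact ⟨⟨p, hp⟩, hx⟩
  surjective_toY y := by
    obtain ⟨p, hp, hy⟩ := h₂ y
    exact ⟨⟨p, hp⟩, hy⟩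

/-- A tripod that factors through a surjection from another tripod costs no more. -/
theorem Tripod.cost_le_of_surjective {X Y : FilteredSpace.{u}} {S T : Tripod X Y} {f : T.Z → S.Z}
    (hf : Function.Surjective f) (hX : ∀ z, S.toX (f z) = T.toX z)
    (hY : ∀ z, S.toY (f z) = T.toY z) : S.cost ≤ T.cost := by
  classical
  refine iSup_le fun τ => ?_
  obtain ⟨σ, rfl⟩ : ∃ σ : Finset T.Z, σ.image f = τ := by
    obtain ⟨g, hg⟩ := hf.hasRightInverse
    exact ⟨τ.image g, by rw [Finset.image_image, hg.comp_eq_id, Finset.image_id]⟩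
  refine le_of_eq_of_le ?_
    (le_iSup (fun τ => ENNReal.ofReal |X.pullback T.toX τ - Y.pullback T.toY τ|) σ)
  have h₁ : S.toX ∘ f = T.toX := funext hX
  have h₂ : S.toY ∘ f = T.toY := funext hY
  unfold FilteredSpace.pullback
  rw [← h₁, ← h₂, ← Finset.image_image, ← Finset.image_image]

/-- Replacing `Z` by its image in `X × Y` does not raise the cost, so it suffices to minimize over
the finite set of correspondences. It contains the full product because both spaces are nonempty. -/
theorem Tripod.exists_isOptimal {X Y : FilteredSpace.{u}} [hX : Nonempty X.carrier]
    [hY : Nonempty Y.carrier] : ∃ T : Tripod X Y, T.IsOptimal := by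
  let I := {R : Set (X.carrier × Y.carrier) // (∀ x, ∃ p ∈ R, p.1 = x) ∧ ∀ y, ∃ p ∈ R, p.2 = y}
  have : Nonempty I := ⟨⟨Set.univ, fun x => ⟨(x, Classical.arbitrary _), trivial, rfl⟩,
    fun y => ⟨(Classical.arbitrary _, y), trivial, rfl⟩⟩⟩
  obtain ⟨R, hR⟩ := Finite.exists_min fun R : I => (Tripod.ofSet R.1 R.2.1 R.2.2).cost
  refine ⟨Tripod.ofSet R.1 R.2.1 R.2.2, le_antisymm (le_iInf fun T => ?_) (iInf_le _ _)⟩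
  let f : T.Z → X.carrier × Y.carrier := fun z => (T.toX z, T.toY z)
  let Q : I := ⟨Set.range f,
    fun x => (T.surjective_toX x).elim fun z hz => ⟨f z, ⟨z, rfl⟩, hz⟩,
    fun y => (T.surjective_toY y).elim fun z hz => ⟨f z, ⟨z, rfl⟩, hz⟩⟩
  exact (hR Q).trans (Tripod.cost_le_of_surjective (f := Set.rangeFactorization f)
    Set.rangeFactorization_surjective (fun _ => rfl) fun _ => rfl)

theorem theorem6p2 (𝕜 : Type v) [Field 𝕜] (k : ℕ) (X Y : FilteredSpace.{u}) :
    -- persistence diagrams are well defined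
    (∀ W : FilteredSpace.{u},
      ∃! D : PersistenceDiagram, IsBarcode (W.persistentHomology 𝕜 k) D) ∧
    -- the bound on the length
    (⨆ (T : Tripod X Y) (_ : T.IsOptimal), diagramLength fun t => (T.curve t).diagram 𝕜 k)
      ≤ filteredDist X Y ∧
    -- it is at least as strong as the bound on the bottleneck distance
    (∀ T : Tripod X Y, T.IsOptimal →
      bottleneckDist (X.diagram 𝕜 k) (Y.diagram 𝕜 k)
        ≤ diagramLength fun t => (T.curve t).diagram 𝕜 k) ∧
    (Nonempty X.carrier → Nonempty Y.carrier → ∃ T : Tripod X Y, T.IsOptimal) := by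
  refine ⟨fun W => W.existsUnique_isBarcode 𝕜 k, iSup₂_le fun T hT => ?_, fun T _ => ?_,
    fun _ _ => Tripod.exists_isOptimal⟩
  · exact (T.diagramLength_le_cost 𝕜 k).trans hT.le
  · have h := bottleneckDist_le_diagramLength fun t => (T.curve t).diagram 𝕜 k
    rwa [T.diagram_curve_zero 𝕜 k, T.diagram_curve_one 𝕜 k] at h
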